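/- Let $X$ be a compact Kähler manifold of complex dimension $n$, let $0\le q\le n$ be an integer, and let $L$ be a holomorphic line bundle on $X$. For a smooth hermitian metric $h$ on $L$ let $\sqrt{-1}\Theta_h$ denote its Chern curvature form, i.e. $\sqrt{-1}\Theta_h=-\sqrt{-1}\,\partial\bar\partial\log|s|_h^2$ for any local nowhere vanishing holomorphic section $s$ of $L$. Suppose that $L$ is $q$-positive in the sense of Andreotti–Grauert: there is a smooth hermitian metric on $L$ whose Chern curvature form has at least $n-q$ positive eigenvalues (counted with multiplicity) at every point of $X$. Then there exist a smooth hermitian metric $h$ on $L$ and a smooth positive hermitian form $\omega$ on $X$ (not necessarily closed) such that $\sqrt{-1}\Theta_h$ is $(\omega,n-q)$-subharmonic, i.e. at every point of $X$ the vector $\lambda\in\mathbb{R}^n$ of eigenvalues of $\sqrt{-1}\Theta_h$ with respect to $\omega$ satisfies $\sigma_i(\lambda)>0$ for all $0\le i\le n-q$, where $\sigma_i$ is the $i$-th elementary symmetric function ($\sigma_0=1$). -/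

import Mathlib

open scoped Manifold ContDiff ComplexConjugate
open Bundle

noncomputable section

namespace QPos

/-! ### Elementary symmetric functions and the cones `Γ_k` -/

/-- The `k`-th elementary symmetric function `σ_k` on `ℝⁿ`. -/
def sigma {n : ℕ} (k : ℕ) (lam : Fin n → ℝ) : ℝ :=
  ∑ s ∈ Finset.powersetCard k (Finset.univ : Finset (Fin n)), ∏ i ∈ s, lam i

/-- The admissible cone `Γ_k = {λ ∈ ℝⁿ | σ_i(λ) > 0 for 0 ≤ i ≤ k}`. -/
def admissibleCone (n k : ℕ) : Set (Fin n → ℝ) :=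
  {lam | ∀ i ≤ k, 0 < sigma i lam}

/-! ### Hermitian forms on a complex vector space -/

section Pointwise

variable {V : Type*} [AddCommGroup V] [Module ℂ V]

/-- `lam` is the vector of eigenvalues (with multiplicity) of the hermitian form `α` with respect
to the positive hermitian form `g`: some basis is orthonormal for `g` and diagonalises `α` with
diagonal entries `lam`. The vector `lam` is unique up to permutation, and existence of the basis
forces `g` to be hermitian and positive definite and `α` to be hermitian. -/
def IsEigenvalueVector {n : ℕ} (g α : V →ₗ[ℂ] V →ₗ⋆[ℂ] ℂ) (lam : Fin n → ℝ) : Prop :=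
  ∃ b : Module.Basis (Fin n) ℂ V,
    (∀ i j, g (b i) (b j) = if i = j then 1 else 0) ∧
    (∀ i j, α (b i) (b j) = if i = j then (lam i : ℂ) else 0)

/-- The hermitian form `α` on an `n`-dimensional space has at least `n - q` positive eigenvalues
(with multiplicity). The eigenvalues are taken with respect to some auxiliary hermitian inner
product `g`; by the law of inertia the number of positive ones does not depend on `g`. -/
def HasPositiveEigenvalues (n q : ℕ) (α : V →ₗ[ℂ] V →ₗ⋆[ℂ] ℂ) : Prop :=
  ∃ (g : V →ₗ[ℂ] V →ₗ⋆[ℂ] ℂ) (lam : Fin n → ℝ),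
    IsEigenvalueVector g α lam ∧ n ≤ q + (Finset.univ.filter fun i => 0 < lam i).card

end Pointwise

/-! ### Wirtinger derivatives on `ℂⁿ` -/

/-- The model space `ℂⁿ`. -/
abbrev Cn (n : ℕ) : Type := EuclideanSpace ℂ (Fin n)

/-- The `i`-th standard basis vector of `ℂⁿ`. -/
abbrev stdVec {n : ℕ} (i : Fin n) : Cn n := EuclideanSpace.single i (1 : ℂ)

/-- `∂f/∂z_i = (∂f/∂x_i - √-1 ∂f/∂y_i) / 2`. -/
def dz {n : ℕ} (i : Fin n) (f : Cn n → ℂ) (z : Cn n) : ℂ :=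
  (fderiv ℝ f z (stdVec i) - Complex.I * fderiv ℝ f z (Complex.I • stdVec i)) / 2

/-- `∂f/∂z̄_i = (∂f/∂x_i + √-1 ∂f/∂y_i) / 2`. -/
def dzbar {n : ℕ} (i : Fin n) (f : Cn n → ℂ) (z : Cn n) : ℂ :=
  (fderiv ℝ f z (stdVec i) + Complex.I * fderiv ℝ f z (Complex.I • stdVec i)) / 2

section Manifold

variable {n : ℕ} {X : Type*} [TopologicalSpace X] [ChartedSpace (Cn n) X]

/-- The holomorphic tangent space of `X` at `x`. -/
abbrev HolTangent (n : ℕ) {X : Type*} [TopologicalSpace X] [ChartedSpace (Cn n) X] (x : X) :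
    Type :=
  TangentSpace 𝓘(ℂ, Cn n) x

/-- A field of sesquilinear forms on the tangent spaces of `X`; the `(1,1)`-form
`√-1 ∑ g_{ij̄} dz_i ∧ dz̄_j` is identified with `(u, v) ↦ ∑ g_{ij̄} u_i v̄_j`. -/
abbrev SesqField (n : ℕ) (X : Type*) [TopologicalSpace X] [ChartedSpace (Cn n) X] : Type _ :=
  ∀ x : X, HolTangent n x →ₗ[ℂ] HolTangent n x →ₗ⋆[ℂ] ℂ

/-- The coefficient `g_{ij̄} = g(∂/∂z_i, ∂/∂z_j)` of `g` in the chart `φ`, as a function of the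
coordinate `z ∈ φ.target`. -/
def SesqField.coeff (g : SesqField n X) (φ : OpenPartialHomeomorph X (Cn n)) (i j : Fin n)
    (z : Cn n) : ℂ :=
  g (φ.symm z) (mfderiv 𝓘(ℂ, Cn n) 𝓘(ℂ, Cn n) φ.symm z (stdVec i))
    (mfderiv 𝓘(ℂ, Cn n) 𝓘(ℂ, Cn n) φ.symm z (stdVec j))

/-- A smooth (positive definite) hermitian form on the complex manifold `X`. -/
structure HermitianForm (n : ℕ) (X : Type*) [TopologicalSpace X] [ChartedSpace (Cn n) X] where
  form : SesqField n X
  conj_symm : ∀ x u v, form x u v = conj (form x v u)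
  pos : ∀ x u, u ≠ 0 → 0 < (form x u u).re
  smooth : ∀ φ ∈ atlas (Cn n) X, ∀ i j, ContDiffOn ℝ ∞ (form.coeff φ i j) φ.target

/-- The fundamental form `√-1 ∑ g_{ij̄} dz_i ∧ dz̄_j` is `d`-closed, that is,
`∂g_{ij̄}/∂z_k = ∂g_{kj̄}/∂z_i` in all charts. -/
def HermitianForm.IsKahler (g : HermitianForm n X) : Prop :=
  ∀ φ ∈ atlas (Cn n) X, ∀ z ∈ φ.target, ∀ i j k,
    dz k (g.form.coeff φ i j) z = dz i (g.form.coeff φ k j) z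

/-- `X` admits a Kähler metric. -/
def IsKahlerManifold (n : ℕ) (X : Type*) [TopologicalSpace X] [ChartedSpace (Cn n) X] : Prop :=
  ∃ g : HermitianForm n X, g.IsKahler

/-- The field `α` is (strictly) `(g, k)`-subharmonic: at each point its eigenvalue vector
with respect to `g` lies in `Γ_k`. -/
def IsSubharmonic (α : SesqField n X) (g : HermitianForm n X) (k : ℕ) : Prop :=
  ∀ x, ∃ lam ∈ admissibleCone n k, IsEigenvalueVector (g.form x) (α x) lam

/-! ### Hermitian metrics on line bundles and their Chern curvature -/

variable (n) (L : X → Type*) [∀ x, AddCommGroup (L x)] [∀ x, Module ℂ (L x)]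
  [∀ x, TopologicalSpace (L x)] [TopologicalSpace (TotalSpace ℂ L)] [FiberBundle ℂ L]

/-- A smooth hermitian metric on the line bundle `L`. Smoothness: for the frame
`s_e(x) = e⁻¹(x, 1)` of a trivialization `e`, the function `|s_e|²_h` is smooth in the real
sense. -/
structure HermitianMetric where
  inner : ∀ x, L x →ₗ[ℂ] L x →ₗ⋆[ℂ] ℂ
  conj_symm : ∀ x u v, inner x u v = conj (inner x v u)
  pos : ∀ x u, u ≠ 0 → 0 < (inner x u u).re
  smooth : ∀ (e : Trivialization ℂ (TotalSpace.proj : TotalSpace ℂ L → X))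
    [MemTrivializationAtlas e],
    ContMDiffOn 𝓘(ℝ, Cn n) 𝓘(ℝ, ℝ) ∞ (fun x => (inner x (e.symm x 1) (e.symm x 1)).re) e.baseSet

namespace HermitianMetric

variable {n L}

/-- The function `log |s_e|²_h` for the frame `s_e(x) = e⁻¹(x, 1)`, read in the chart `φ`. -/
def logNormSq (h : HermitianMetric n L) (φ : OpenPartialHomeomorph X (Cn n))
    (e : Trivialization ℂ (TotalSpace.proj : TotalSpace ℂ L → X)) (z : Cn n) : ℂ :=
  (Real.log (h.inner (φ.symm z) (e.symm (φ.symm z) 1) (e.symm (φ.symm z) 1)).re : ℂ)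

/-- The coefficients `-∂²/∂z_i∂z̄_j log |s_e|²_h` of
`√-1 Θ_h = -√-1 ∂∂̄ log |s_e|²_h` in the chart `φ`. -/
def curvatureCoeff (h : HermitianMetric n L) (φ : OpenPartialHomeomorph X (Cn n))
    (e : Trivialization ℂ (TotalSpace.proj : TotalSpace ℂ L → X)) (i j : Fin n) (z : Cn n) : ℂ :=
  - dz i (dzbar j (h.logNormSq φ e)) z

/-- The coordinates of the tangent vector `u` at `x` in the chart `φ`. -/
def coordAt (φ : OpenPartialHomeomorph X (Cn n)) (x : X) (i : Fin n) :
    HolTangent n x →ₗ[ℂ] ℂ :=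
  (EuclideanSpace.proj i : Cn n →L[ℂ] ℂ).toLinearMap ∘ₗ
    (mfderiv 𝓘(ℂ, Cn n) 𝓘(ℂ, Cn n) φ x).toLinearMap

/-- The Chern curvature form `√-1 Θ_h` at `x`, computed in the chart `φ` and the frame `s_e`:
`(u, v) ↦ ∑ -(∂²/∂z_i∂z̄_j log |s_e|²_h) u_i v̄_j`. -/
def curvatureIn (h : HermitianMetric n L) (φ : OpenPartialHomeomorph X (Cn n))
    (e : Trivialization ℂ (TotalSpace.proj : TotalSpace ℂ L → X)) (x : X) :
    HolTangent n x →ₗ[ℂ] HolTangent n x →ₗ⋆[ℂ] ℂ :=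
  LinearMap.mk₂'ₛₗ (RingHom.id ℂ) (starRingEnd ℂ)
    (fun u v => ∑ i, ∑ j,
      h.curvatureCoeff φ e i j (φ x) * (coordAt φ x i u * conj (coordAt φ x j v)))
    (fun u u' v => by
      simp only [map_add, add_mul, mul_add, Finset.sum_add_distrib])
    (fun c u v => by
      simp only [map_smul, smul_eq_mul, RingHom.id_apply, Finset.mul_sum]
      refine Finset.sum_congr rfl fun i _ => Finset.sum_congr rfl fun j _ => ?_
      ring)
    (fun u v v' => by
      simp only [map_add, mul_add, Finset.sum_add_distrib])
    (fun c u v => by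
      simp only [map_smul, smul_eq_mul, map_mul, Finset.mul_sum]
      refine Finset.sum_congr rfl fun i _ => Finset.sum_congr rfl fun j _ => ?_
      ring)

/-- The Chern curvature form `√-1 Θ_h`. At `x` it is computed in the preferred chart and the
preferred local frame at `x`; on a holomorphic line bundle over a complex manifold the result does
not depend on these choices. -/
def chernCurvature (h : HermitianMetric n L) : SesqField n X :=
  fun x => h.curvatureIn (chartAt (Cn n) x) (trivializationAt ℂ L x) x

end HermitianMetric

/-- `L` is `q`-positive (Andreotti–Grauert): there is a smooth hermitian metric whose Chern
curvature has at least `n - q` positive eigenvalues at every point. -/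
def IsQPositive (q : ℕ) : Prop :=
  ∃ h : HermitianMetric n L, ∀ x, HasPositiveEigenvalues n q (h.chernCurvature x)

end Manifold

end QPos

end

/-! The metric on `L` is kept and only the positive form is changed. Let `α` be the curvature of a
`q`-positive metric and `g` any smooth positive hermitian form. By compactness there are constants
`0 < δ ≤ R` such that at every point the eigenvalues `λ_i` of `α` with respect to `g` satisfy `|λ_i|
≤ R`, and at least `n - q` of them are `≥ δ` (`exists_boundedAt`).

Write `α = g(A ·, ·)` and put `ω = g((1 - cA)^N ·, ·)` with `c = 1/(2R)`. Since `cλ_i ≤ 1/2`, this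
form is positive, and the eigenvalues of `α` with respect to it are `λ_i / (1 - cλ_i)^N`
(`IsEigenvalueVector.comp_pow`). Those with `λ_i ≥ δ` grow geometrically in `N`, while negative ones
are divided by a number `≥ 1` and stay `≥ -R`. For large `N` the `n - q` huge entries dominate, so
`σ_i > 0` for `i ≤ n - q` (`sigma_pos`, `exists_pow_sigma_pos`).

Because `ω` is polynomial in `A`, its smoothness needs no smooth choice of eigenvalues or
eigenvectors: Gram matrices only get multiplied and inverted (`gram_comp_endomorphism`). The
curvature is computed in a chart and frame that vary with the point, so its own smoothness rests on
`curvatureIn_eq`: the complex Hessian is natural under holomorphic maps, and `log |c|²` is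
pluriharmonic for a nonvanishing holomorphic `c`. -/

noncomputable section

namespace QPos

/-! ### Positivity of elementary symmetric functions -/

/-- If `k` entries of `mu` are at least `M` and all entries are at least `-R` with `M` large
compared to `R`, then `σ_i(mu) > 0` for all `i ≤ k`. -/
theorem sigma_pos {n : ℕ} {mu : Fin n → ℝ} {R M : ℝ} (hR : 0 < R) (hRM : R * 2 ^ n < M)
    {K : Finset (Fin n)} (hK : ∀ j ∈ K, M ≤ mu j) (hmu : ∀ j, -R ≤ mu j) {i : ℕ}
    (hi : i ≤ K.card) : 0 < sigma i mu := by
  classical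
  have hRM' : R ≤ M := by
    have : (1 : ℝ) ≤ 2 ^ n := one_le_pow₀ (by norm_num)
    nlinarith
  have hM : 0 < M := hR.trans_le hRM'
  set P : Finset (Fin n) := Finset.univ.filter fun j => 0 ≤ mu j with hP
  have hKP : K ⊆ P := fun j hj => by simp [hP, hM.le.trans (hK j hj)]
  obtain ⟨sK, hsK, hsKc⟩ := Finset.exists_subset_card_eq hi
  have hsKT : sK ∈ P.powersetCard i := Finset.mem_powersetCard.2 ⟨hsK.trans hKP, hsKc⟩
  -- The largest product `m` over `i`-subsets of nonnegative entries is the yardstick: it will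
  -- outweigh all terms that contain a negative entry.
  obtain ⟨t, ht, hmax⟩ := Finset.exists_max_image (P.powersetCard i) (fun s => ∏ j ∈ s, mu j)
    ⟨sK, hsKT⟩
  set m := ∏ j ∈ t, mu j with hm
  have hmpos : 0 < m := lt_of_lt_of_le
    (Finset.prod_pos fun j hj => hM.trans_le (hK j (hsK hj))) (hmax sK hsKT)
  have hsub : P.powersetCard i ⊆ Finset.powersetCard i (Finset.univ : Finset (Fin n)) :=
    Finset.powersetCard_mono (Finset.subset_univ _)
  have hbad : ∀ s ∈ Finset.powersetCard i (Finset.univ : Finset (Fin n)) \ P.powersetCard i,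
      -(R * m) ≤ M * ∏ j ∈ s, mu j := by
    intro s hs
    rw [Finset.mem_sdiff, Finset.mem_powersetCard, Finset.mem_powersetCard] at hs
    obtain ⟨⟨-, hsc⟩, hsP⟩ := hs
    set N := s.filter fun j => mu j < 0 with hN
    set P' := s.filter fun j => ¬ mu j < 0 with hP'
    have hcard : N.card + P'.card = i := by
      rw [hN, hP', Finset.card_filter_add_card_filter_not, hsc]
    have hNc : 1 ≤ N.card := by
      rw [Nat.one_le_iff_ne_zero]
      intro h0
      refine hsP ⟨fun j hj => ?_, hsc⟩
      rw [Finset.card_eq_zero, hN, Finset.filter_eq_empty_iff] at h0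
      simpa [hP] using h0 hj
    -- As `i ≤ K.card`, there are enough large entries outside `P'` to replace the negative ones;
    -- the new product is at most `m`.
    have hKc : N.card ≤ (K \ P').card := by
      have := Finset.le_card_sdiff P' K
      omega
    obtain ⟨D, hD, hDc⟩ := Finset.exists_subset_card_eq hKc
    have hdisj : Disjoint P' D := by
      rw [Finset.disjoint_left]
      intro j hj hj'
      exact (Finset.mem_sdiff.1 (hD hj')).2 hj
    have hP'0 : 0 ≤ ∏ j ∈ P', mu j :=
      Finset.prod_nonneg fun j hj => not_lt.1 (Finset.mem_filter.1 hj).2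
    have h1 : (∏ j ∈ P', mu j) * M ^ N.card ≤ m := by
      have hmem : P' ∪ D ∈ P.powersetCard i := by
        rw [Finset.mem_powersetCard, Finset.card_union_of_disjoint hdisj, hDc]
        refine ⟨Finset.union_subset (fun j hj => ?_) fun j hj => hKP (Finset.mem_sdiff.1 (hD hj)).1,
          by omega⟩
        simpa [hP] using (Finset.mem_filter.1 hj).2
      refine le_trans ?_ (hmax _ hmem)
      rw [Finset.prod_union hdisj]
      refine mul_le_mul_of_nonneg_left ?_ hP'0
      rw [← hDc, ← Finset.prod_const]
      exact Finset.prod_le_prod (fun _ _ => hM.le)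
        fun j hj => hK j (Finset.mem_sdiff.1 (hD hj)).1
    have h2 : |∏ j ∈ N, mu j| ≤ R ^ N.card := by
      rw [Finset.abs_prod, ← Finset.prod_const]
      refine Finset.prod_le_prod (fun _ _ => abs_nonneg _) fun j hj => abs_le.2 ⟨hmu j, ?_⟩
      exact (Finset.mem_filter.1 hj).2.le.trans hR.le
    -- At least one factor is replaced, which gains a full factor `R / M`.
    have h3 : M * R ^ N.card ≤ R * M ^ N.card := by
      obtain ⟨c, hc⟩ := Nat.exists_eq_add_of_le hNc
      have := pow_le_pow_left₀ hR.le hRM' c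
      rw [hc, pow_add, pow_add, pow_one, pow_one]
      nlinarith [mul_le_mul_of_nonneg_left this (mul_pos hR hM).le]
    have hprod : ∏ j ∈ s, mu j = (∏ j ∈ N, mu j) * ∏ j ∈ P', mu j :=
      (Finset.prod_filter_mul_prod_filter_not s _ _).symm
    have h4 : M * |∏ j ∈ s, mu j| ≤ R * m := by
      rw [hprod, abs_mul, abs_of_nonneg hP'0]
      calc M * (|∏ j ∈ N, mu j| * ∏ j ∈ P', mu j)
          ≤ M * (R ^ N.card * ∏ j ∈ P', mu j) := by gcongr
        _ = (M * R ^ N.card) * ∏ j ∈ P', mu j := by ring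
        _ ≤ (R * M ^ N.card) * ∏ j ∈ P', mu j := by gcongr
        _ = R * ((∏ j ∈ P', mu j) * M ^ N.card) := by ring
        _ ≤ R * m := by gcongr
    have h5 := mul_le_mul_of_nonneg_left (neg_abs_le (∏ j ∈ s, mu j)) hM.le
    linarith
  have hgood : m ≤ ∑ s ∈ P.powersetCard i, ∏ j ∈ s, mu j := by
    refine Finset.single_le_sum (f := fun s => ∏ j ∈ s, mu j) (fun s hs => ?_) ht
    refine Finset.prod_nonneg fun j hj => ?_
    simpa [hP] using (Finset.mem_powersetCard.1 hs).1 hj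
  have hcardle : ((Finset.powersetCard i (Finset.univ : Finset (Fin n)) \
      P.powersetCard i).card : ℝ) ≤ 2 ^ n := by
    have : (Finset.powersetCard i (Finset.univ : Finset (Fin n)) \ P.powersetCard i).card
        ≤ (Finset.powerset (Finset.univ : Finset (Fin n))).card :=
      Finset.card_le_card fun s _ => by simp
    rw [Finset.card_powerset, Finset.card_univ, Fintype.card_fin] at this
    exact_mod_cast this
  have hsum := Finset.sum_le_sum hbad
  rw [Finset.sum_const, nsmul_eq_mul, ← Finset.mul_sum] at hsum
  have hsplit := Finset.sum_sdiff hsub (f := fun s => ∏ j ∈ s, mu j)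
  -- After scaling by `M`, the good terms give at least `M * m` and the at most `2 ^ n` bad ones
  -- cost at most `R * m` each.
  have hfin : 0 < M * sigma i mu := by
    rw [sigma, ← hsplit, mul_add]
    have e1 := mul_le_mul_of_nonneg_left hgood hM.le
    have e2 := mul_le_mul_of_nonneg_right hcardle (mul_pos hR hmpos).le
    have e3 := mul_lt_mul_of_pos_right hRM hmpos
    nlinarith
  exact pos_of_mul_pos_right hfin hM.le

/-! ### Hermitian forms and their eigenvalues -/

section Pointwise

variable {V : Type*} [AddCommGroup V] [Module ℂ V] {n : ℕ}
  {g α : V →ₗ[ℂ] V →ₗ⋆[ℂ] ℂ} {lam : Fin n → ℝ}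

theorem sesq_apply_sum (α : V →ₗ[ℂ] V →ₗ⋆[ℂ] ℂ) (b : Fin n → V) (c d : Fin n → ℂ) :
    α (∑ i, c i • b i) (∑ j, d j • b j) =
      ∑ i, ∑ j, α (b i) (b j) * (c i * conj (d j)) := by
  simp only [map_sum, map_smul, LinearMap.sum_apply, LinearMap.smul_apply, LinearMap.map_smulₛₗ,
    smul_eq_mul, Finset.mul_sum]
  rw [Finset.sum_comm]
  refine Finset.sum_congr rfl fun i _ => Finset.sum_congr rfl fun j _ => ?_
  ring

/-- The value of a form in a basis that diagonalises it. -/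
theorem apply_of_diagonal (b : Module.Basis (Fin n) ℂ V)
    (h : ∀ i j, α (b i) (b j) = if i = j then (lam i : ℂ) else 0) (u v : V) :
    α u v = ∑ i, (lam i : ℂ) * (b.repr u i * conj (b.repr v i)) := by
  conv_lhs => rw [← b.sum_repr u, ← b.sum_repr v]
  rw [sesq_apply_sum]
  simp [h]

theorem re_apply_self_of_diagonal (b : Module.Basis (Fin n) ℂ V)
    (h : ∀ i j, α (b i) (b j) = if i = j then (lam i : ℂ) else 0) (v : V) :
    (α v v).re = ∑ i, lam i * ‖b.repr v i‖ ^ 2 := by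
  rw [apply_of_diagonal b h, Complex.re_sum]
  refine Finset.sum_congr rfl fun i _ => ?_
  rw [Complex.mul_conj, ← Complex.ofReal_mul, Complex.ofReal_re, Complex.normSq_eq_norm_sq]

theorem conj_symm_of_diagonal (b : Module.Basis (Fin n) ℂ V)
    (h : ∀ i j, α (b i) (b j) = if i = j then (lam i : ℂ) else 0) (u v : V) :
    α u v = conj (α v u) := by
  rw [apply_of_diagonal b h, apply_of_diagonal b h, map_sum]
  refine Finset.sum_congr rfl fun i _ => ?_
  simp only [map_mul, Complex.conj_ofReal, Complex.conj_conj]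
  ring

theorem IsEigenvalueVector.conj_symm_left (h : IsEigenvalueVector g α lam) (u v : V) :
    g u v = conj (g v u) := by
  obtain ⟨b, hg, -⟩ := h
  exact conj_symm_of_diagonal (lam := fun _ => 1) b (by simpa using hg) u v

theorem IsEigenvalueVector.conj_symm_right (h : IsEigenvalueVector g α lam) (u v : V) :
    α u v = conj (α v u) := by
  obtain ⟨b, -, hα⟩ := h
  exact conj_symm_of_diagonal b hα u v

theorem IsEigenvalueVector.pos_left (h : IsEigenvalueVector g α lam) (u : V) (hu : u ≠ 0) :
    0 < (g u u).re := by
  obtain ⟨b, hg, -⟩ := h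
  rw [re_apply_self_of_diagonal (lam := fun _ => 1) b (by simpa using hg)]
  simp only [one_mul]
  have hne : b.repr u ≠ 0 := by simpa using hu
  obtain ⟨i, hi⟩ := Finsupp.ne_iff.1 hne
  exact Finset.sum_pos' (fun _ _ => by positivity)
    ⟨i, Finset.mem_univ _, by have : b.repr u i ≠ 0 := hi
                              positivity⟩

/-- A sesquilinear form is represented by an endomorphism with respect to a form that has an
orthonormal basis. -/
theorem exists_representing_endomorphism (b : Module.Basis (Fin n) ℂ V)
    (hg : ∀ i j, g (b i) (b j) = if i = j then 1 else 0) (α : V →ₗ[ℂ] V →ₗ⋆[ℂ] ℂ) :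
    ∃ A : V →ₗ[ℂ] V, ∀ u v, α u v = g (A u) v := by
  refine ⟨∑ i, (α.flip (b i)).smulRight (b i), fun u v => ?_⟩
  suffices h : α u = g ((∑ i, (α.flip (b i)).smulRight (b i)) u) by rw [h]
  refine b.ext fun j => ?_
  simp [LinearMap.sum_apply, hg]

/-- The spectral theorem for the endomorphism representing `α`, self-adjoint for the inner product
`g`. -/
theorem exists_isEigenvalueVector [FiniteDimensional ℂ V] (hn : Module.finrank ℂ V = n)
    (hgs : ∀ u v, g u v = conj (g v u)) (hgp : ∀ u, u ≠ 0 → 0 < (g u u).re)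
    (hα : ∀ u v, α u v = conj (α v u)) : ∃ lam : Fin n → ℝ, IsEigenvalueVector g α lam := by
  let core : InnerProductSpace.Core ℂ V :=
    -- The arguments are swapped because `inner` is conjugate-linear in its first slot, `g` in its
    -- second.
    { inner := fun u v => g v u
      conj_inner_symm := fun u v => (hgs v u).symm
      re_inner_nonneg := fun u => by
        rcases eq_or_ne u 0 with rfl | hu
        · simp
        · exact (hgp u hu).le
      add_left := fun u v w => by simp
      smul_left := fun u v r => by simp
      definite := fun u h => by
        by_contra hu
        have := hgp u hu
        rw [h] at this
        simp at this }
  let _ : NormedAddCommGroup V := core.toNormedAddCommGroup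
  let _ : InnerProductSpace ℂ V := InnerProductSpace.ofCore core.toCore
  have hin : ∀ u v : V, inner ℂ u v = g v u := fun _ _ => rfl
  have hstd : ∀ i j, g ((stdOrthonormalBasis ℂ V).toBasis.reindex (finCongr hn) i)
      ((stdOrthonormalBasis ℂ V).toBasis.reindex (finCongr hn) j) = if i = j then 1 else 0 := by
    intro i j
    simp only [Module.Basis.reindex_apply, OrthonormalBasis.coe_toBasis, ← hin]
    rw [orthonormal_iff_ite.1 (stdOrthonormalBasis ℂ V).orthonormal]
    simp [eq_comm]
  obtain ⟨A, hA⟩ := exists_representing_endomorphism _ hstd α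
  have hsym : A.IsSymmetric := fun u v => by
    rw [hin, hin, ← hA, hgs, ← hA, ← hα]
  refine ⟨hsym.eigenvalues hn, (hsym.eigenvectorBasis hn).toBasis, fun i j => ?_, fun i j => ?_⟩
  · rw [← hin]
    simp only [OrthonormalBasis.coe_toBasis]
    rw [orthonormal_iff_ite.1 (hsym.eigenvectorBasis hn).orthonormal]
    simp [eq_comm]
  · rw [hA, ← hin]
    simp only [OrthonormalBasis.coe_toBasis]
    rw [hsym.apply_eigenvectorBasis, inner_smul_right,
      orthonormal_iff_ite.1 (hsym.eigenvectorBasis hn).orthonormal]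
    simp [eq_comm]

theorem finrank_span_basis_image (b : Module.Basis (Fin n) ℂ V) (J : Finset (Fin n)) :
    Module.finrank ℂ (Submodule.span ℂ (b '' (J : Set (Fin n)))) = J.card := by
  have e : b '' (J : Set (Fin n)) = Set.range (b ∘ ((↑) : J → Fin n)) := by
    ext; simp
  rw [e, finrank_span_eq_card (b.linearIndependent.comp _ Subtype.val_injective)]
  simp

/-- A hermitian form with at least `n - q` positive eigenvalues is positive on a subspace of
dimension at least `n - q`. -/
theorem HasPositiveEigenvalues.exists_submodule {q : ℕ} (h : HasPositiveEigenvalues n q α) :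
    ∃ W : Submodule ℂ V, n - q ≤ Module.finrank ℂ W ∧ ∀ v ∈ W, v ≠ 0 → 0 < (α v v).re := by
  obtain ⟨g, lam, ⟨b, -, hα⟩, hq⟩ := h
  refine ⟨Submodule.span ℂ (b '' (Finset.univ.filter fun i => 0 < lam i : Finset (Fin n))),
    ?_, fun v hv hv0 => ?_⟩
  · rw [finrank_span_basis_image]
    omega
  · rw [re_apply_self_of_diagonal b hα]
    rw [Module.Basis.mem_span_image] at hv
    have hpos : ∀ i, b.repr v i ≠ 0 → 0 < lam i * ‖b.repr v i‖ ^ 2 := fun i hi => by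
      have h1 : 0 < lam i := by simpa using hv (by simpa using hi)
      positivity
    have hne : b.repr v ≠ 0 := by simpa using hv0
    obtain ⟨i, hi⟩ := Finsupp.ne_iff.1 hne
    refine Finset.sum_pos' (fun j _ => ?_) ⟨i, Finset.mem_univ _, hpos i hi⟩
    by_cases hj : b.repr v j = 0
    · simp [hj]
    · exact (hpos j hj).le

/-- If `α > δ g` on a subspace `W`, at least `dim W` eigenvalues of `α` are at least `δ`. -/
theorem IsEigenvalueVector.finrank_le_card (h : IsEigenvalueVector g α lam) {δ : ℝ}
    {W : Submodule ℂ V} (hW : ∀ v ∈ W, v ≠ 0 → δ * (g v v).re < (α v v).re) :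
    Module.finrank ℂ W ≤ (Finset.univ.filter fun i => δ ≤ lam i).card := by
  obtain ⟨b, hg, hα⟩ := h
  have : FiniteDimensional ℂ V := b.finiteDimensional_of_finite
  set J : Finset (Fin n) := Finset.univ.filter fun i => ¬ δ ≤ lam i with hJ
  -- On the span of the eigenvectors with eigenvalue below `δ` one has `α ≤ δ g`, so `W` meets it
  -- only in `0`; then count dimensions.
  set U : Submodule ℂ V := Submodule.span ℂ (b '' (J : Set (Fin n))) with hU
  have hUd : Module.finrank ℂ U = J.card := finrank_span_basis_image b J
  have hdisj : Disjoint W U := by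
    rw [Submodule.disjoint_def]
    intro v hvW hvU
    by_contra hv
    have h1 := hW v hvW hv
    rw [re_apply_self_of_diagonal b hα,
      re_apply_self_of_diagonal (lam := fun _ => 1) b (by simpa using hg), Finset.mul_sum] at h1
    refine absurd h1 (not_lt.2 (Finset.sum_le_sum fun i _ => ?_))
    rw [hU, Module.Basis.mem_span_image] at hvU
    by_cases hi : b.repr v i = 0
    · simp [hi]
    · have : i ∈ J := hvU (by simpa using hi)
      have : lam i < δ := by simpa [hJ] using this
      rw [one_mul]
      gcongr
  have h2 := Submodule.finrank_add_finrank_le_of_disjoint hdisj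
  rw [hUd, Module.finrank_eq_card_basis b, Fintype.card_fin] at h2
  have h3 : (Finset.univ.filter fun i => δ ≤ lam i).card + J.card = n := by
    rw [hJ, Finset.card_filter_add_card_filter_not, Finset.card_univ, Fintype.card_fin]
  omega

theorem IsEigenvalueVector.abs_le (h : IsEigenvalueVector g α lam) {R : ℝ}
    (hR : ∀ v, v ≠ 0 → |(α v v).re| ≤ R * (g v v).re) (i : Fin n) : |lam i| ≤ R := by
  obtain ⟨b, hg, hα⟩ := h
  simpa [hg, hα] using hR (b i) (b.ne_zero i)

/-- Rescaling `g` by `(1 - c A) ^ N`, where `A` is the endomorphism representing `α`, divides the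
eigenvalues `λ` of `α` by `(1 - c λ) ^ N`. -/
theorem IsEigenvalueVector.comp_pow (h : IsEigenvalueVector g α lam) {A : V →ₗ[ℂ] V}
    (hA : ∀ u v, α u v = g (A u) v) {c : ℝ} (hc : ∀ i, 0 < 1 - c * lam i) (N : ℕ) :
    IsEigenvalueVector (g.comp ((1 - (c : ℂ) • A) ^ N)) α
      (fun i => lam i / (1 - c * lam i) ^ N) := by
  have hpos := h.pos_left
  obtain ⟨b, hg, hα⟩ := h
  -- The basis diagonalising `α` consists of eigenvectors of `A`, since `g` is nondegenerate.
  have hAb : ∀ i, A (b i) = (lam i : ℂ) • b i := by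
    intro i
    rw [← sub_eq_zero]
    by_contra hne
    have h0 : g (A (b i) - (lam i : ℂ) • b i) = 0 := by
      refine b.ext fun j => ?_
      rw [map_sub, LinearMap.sub_apply, ← hA, hα, map_smul, LinearMap.smul_apply, hg]
      simp
    have := hpos _ hne
    rw [h0] at this
    simp at this
  have hB : ∀ i, ((1 - (c : ℂ) • A) ^ N) (b i) = (((1 - c * lam i) ^ N : ℝ) : ℂ) • b i := by
    intro i
    induction N with
    | zero => simp
    | succ N ih =>
      rw [pow_succ', Module.End.mul_apply, ih, map_smul]
      simp only [LinearMap.sub_apply, Module.End.one_apply, LinearMap.smul_apply, hAb]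
      push_cast
      module
  have hd : ∀ i, 0 < (1 - c * lam i) ^ N := fun i => pow_pos (hc i) N
  set d : Fin n → ℝ := fun i => (1 - c * lam i) ^ N with hdd
  have hs : ∀ i, 0 < (√(d i))⁻¹ := fun i => inv_pos.2 (Real.sqrt_pos.2 (hd i))
  have hss : ∀ i, (√(d i))⁻¹ * (√(d i))⁻¹ = (d i)⁻¹ := fun i => by
    rw [← mul_inv, Real.mul_self_sqrt (hd i).le]
  have hu : ∀ i, IsUnit (((√(d i))⁻¹ : ℝ) : ℂ) := fun i => by
    rw [isUnit_iff_ne_zero]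
    exact_mod_cast (hs i).ne'
  -- Dividing each eigenvector by `√(d i)` makes the basis orthonormal for the new form.
  refine ⟨b.isUnitSMul hu, fun i j => ?_, fun i j => ?_⟩
  · simp only [Module.Basis.isUnitSMul_apply, LinearMap.comp_apply, map_smul, hB,
      LinearMap.smul_apply, LinearMap.map_smulₛₗ, hg, Complex.conj_ofReal, smul_eq_mul]
    split_ifs with hij
    · subst hij
      have : (√(d i))⁻¹ * ((√(d i))⁻¹ * d i) = 1 := by
        rw [← mul_assoc, hss, inv_mul_cancel₀ (hd i).ne']
      rw [mul_one]
      calc _ = (((√(d i))⁻¹ * ((√(d i))⁻¹ * d i) : ℝ) : ℂ) := by simp only [hdd]; push_cast; ring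
        _ = 1 := by rw [this]; simp
    · simp
  · simp only [Module.Basis.isUnitSMul_apply, map_smul,
      LinearMap.smul_apply, LinearMap.map_smulₛₗ, hα, Complex.conj_ofReal, smul_eq_mul]
    split_ifs with hij
    · subst hij
      have : (√(d i))⁻¹ * ((√(d i))⁻¹ * lam i) = lam i / d i := by
        rw [← mul_assoc, hss, div_eq_inv_mul]
      calc _ = (((√(d i))⁻¹ * ((√(d i))⁻¹ * lam i) : ℝ) : ℂ) := by push_cast; ring
        _ = _ := by rw [this]
    · simp

/-- Uniform bounds on the eigenvalues give one exponent that works for all forms. -/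
theorem exists_pow_sigma_pos (n : ℕ) {δ R : ℝ} (hδ : 0 < δ) (hδR : δ ≤ R) :
    ∃ N : ℕ, ∀ (lam : Fin n → ℝ), (∀ i, |lam i| ≤ R) →
      ∀ k ≤ (Finset.univ.filter fun i => δ ≤ lam i).card,
        0 < sigma k (fun i => lam i / (1 - (2 * R)⁻¹ * lam i) ^ N) := by
  have hR : 0 < R := hδ.trans_le hδR
  -- An upper bound for `1 - cλ` over all `λ ≥ δ`.
  set r : ℝ := 1 - (2 * R)⁻¹ * δ with hr
  have hle : (2 * R)⁻¹ * δ ≤ 1 / 2 := by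
    rw [inv_mul_le_iff₀ (by positivity)]; linarith
  have hr0 : 0 < r := by linarith
  have hr1 : r < 1 := by
    have : 0 < (2 * R)⁻¹ * δ := by positivity
    linarith
  -- This makes `δ / r ^ N` exceed `R * 2 ^ n`, the threshold in `sigma_pos`.
  obtain ⟨N, hN⟩ := exists_pow_lt_of_lt_one (y := r) (x := δ / (R * 2 ^ n)) (by positivity) hr1
  refine ⟨N, fun lam hlam k hk => ?_⟩
  refine sigma_pos (R := R) (M := δ / r ^ N) hR ?_
    (K := Finset.univ.filter fun i => δ ≤ lam i) (fun j hj => ?_) (fun j => ?_) hk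
  · rw [lt_div_iff₀ (by positivity)] at hN ⊢
    linarith
  all_goals
    have hj' := abs_le.1 (hlam j)
    have hle' : (2 * R)⁻¹ * lam j ≤ 1 / 2 := by
      rw [inv_mul_le_iff₀ (by positivity)]; linarith
  · have hjd : δ ≤ lam j := (Finset.mem_filter.1 hj).2
    have h0 : 0 < 1 - (2 * R)⁻¹ * lam j := by linarith
    have h1 : 1 - (2 * R)⁻¹ * lam j ≤ r := by rw [hr]; gcongr
    have := hδ.le.trans hjd
    gcongr
  · rcases le_or_gt 0 (lam j) with h | h
    · have : 0 ≤ lam j / (1 - (2 * R)⁻¹ * lam j) ^ N :=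
        div_nonneg h (pow_nonneg (by linarith) N)
      linarith
    · have h1 : 1 ≤ (1 - (2 * R)⁻¹ * lam j) ^ N := by
        refine one_le_pow₀ ?_
        have : (2 * R)⁻¹ * lam j < 0 := mul_neg_of_pos_of_neg (by positivity) h
        linarith
      rw [le_div_iff₀ (by linarith)]
      nlinarith

end Pointwise

/-! ### The complex Hessian -/

section LeviForm

theorem differentiableAt_fderiv_of_contDiffAt {E E' : Type*} [NormedAddCommGroup E] [NormedSpace ℝ E]
    [NormedAddCommGroup E'] [NormedSpace ℝ E'] {f : E → E'} {z : E}
    (hf : ContDiffAt ℝ 2 f z) :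
    DifferentiableAt ℝ (fderiv ℝ f) z :=
  (hf.fderiv_right (m := 1) le_rfl).differentiableAt one_ne_zero

variable {E : Type*} [NormedAddCommGroup E] [NormedSpace ℂ E] [NormedSpace ℝ E]
  [IsScalarTower ℝ ℂ E]
  {E' : Type*} [NormedAddCommGroup E'] [NormedSpace ℂ E'] [NormedSpace ℝ E']
  [IsScalarTower ℝ ℂ E']

/-- The complex Hessian `∂∂̄f(u, v̄)` of a function at a point of a complex normed space, expressed
through the real second derivative. -/
def leviForm (f : E → ℂ) (z : E) : E →ₗ[ℂ] E →ₗ⋆[ℂ] ℂ :=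
  LinearMap.mk₂'ₛₗ (RingHom.id ℂ) (starRingEnd ℂ)
    (fun u v => (fderiv ℝ (fderiv ℝ f) z u v
      + Complex.I * fderiv ℝ (fderiv ℝ f) z u (Complex.I • v)
      - Complex.I * fderiv ℝ (fderiv ℝ f) z (Complex.I • u) v
      + fderiv ℝ (fderiv ℝ f) z (Complex.I • u) (Complex.I • v)) / 4)
    (fun u u' v => by
      simp only [map_add, smul_add, add_apply]
      ring)
    (fun c u v => by
      -- The derivatives are only real-linear, so complex scalars are split into real and imaginary
      -- parts.
      have h1 : c • u = c.re • u + c.im • (Complex.I • u) := by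
        conv_lhs => rw [← Complex.re_add_im c]
        rw [add_smul, mul_smul]
        simp only [← Complex.coe_algebraMap, algebraMap_smul]
      have h2 : Complex.I • c • u = c.re • (Complex.I • u) - c.im • u := by
        rw [h1, smul_add, smul_comm Complex.I c.re, smul_comm Complex.I c.im, smul_smul Complex.I,
          Complex.I_mul_I, neg_one_smul, smul_neg, sub_eq_add_neg]
      rw [h1, smul_add, smul_comm Complex.I c.re, smul_comm Complex.I c.im, smul_smul Complex.I,
        Complex.I_mul_I, neg_one_smul]
      simp only [map_add, map_smul, map_neg, smul_neg, add_apply,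
        neg_apply, smul_apply, Complex.real_smul,
        RingHom.id_apply, smul_eq_mul]
      conv_rhs => rw [← Complex.re_add_im c]
      linear_combination (-(1 / 4 : ℂ) * c.im * (fderiv ℝ (fderiv ℝ f) z u (Complex.I • v)
        - fderiv ℝ (fderiv ℝ f) z (Complex.I • u) v)) * Complex.I_mul_I)
    (fun u v v' => by
      simp only [map_add, smul_add]
      ring)
    (fun c u v => by
      have h1 : c • v = c.re • v + c.im • (Complex.I • v) := by
        conv_lhs => rw [← Complex.re_add_im c]
        rw [add_smul, mul_smul]
        simp only [← Complex.coe_algebraMap, algebraMap_smul]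
      rw [h1, smul_add, smul_comm Complex.I c.re, smul_comm Complex.I c.im, smul_smul Complex.I,
        Complex.I_mul_I, neg_one_smul]
      simp only [map_add, map_smul, map_neg, smul_neg, Complex.real_smul, smul_eq_mul]
      conv_rhs => rw [← Complex.re_add_im c]
      simp only [map_add, map_mul, Complex.conj_ofReal, Complex.conj_I]
      linear_combination ((1 / 4 : ℂ) * c.im * (fderiv ℝ (fderiv ℝ f) z u (Complex.I • v)
        - fderiv ℝ (fderiv ℝ f) z (Complex.I • u) v)) * Complex.I_mul_I)

theorem leviForm_apply (f : E → ℂ) (z u v : E) :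
    leviForm f z u v = (fderiv ℝ (fderiv ℝ f) z u v
      + Complex.I * fderiv ℝ (fderiv ℝ f) z u (Complex.I • v)
      - Complex.I * fderiv ℝ (fderiv ℝ f) z (Complex.I • u) v
      + fderiv ℝ (fderiv ℝ f) z (Complex.I • u) (Complex.I • v)) / 4 := rfl

theorem leviForm_congr {f g : E → ℂ} {z : E} (h : f =ᶠ[nhds z] g) :
    leviForm f z = leviForm g z := by
  ext u v
  simp only [leviForm_apply, h.fderiv.fderiv_eq]

theorem leviForm_add {f g : E → ℂ} {z : E} (hf : ContDiffAt ℝ 2 f z) (hg : ContDiffAt ℝ 2 g z) :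
    leviForm (fun y => f y + g y) z = leviForm f z + leviForm g z := by
  have h : fderiv ℝ (fun y => f y + g y) =ᶠ[nhds z] fun y => fderiv ℝ f y + fderiv ℝ g y := by
    filter_upwards [hf.eventually (by simp), hg.eventually (by simp)] with y h1 h2
    exact fderiv_fun_add (h1.differentiableAt two_ne_zero) (h2.differentiableAt two_ne_zero)
  ext u v
  simp only [leviForm_apply, LinearMap.add_apply, h.fderiv_eq]
  rw [fderiv_fun_add (differentiableAt_fderiv_of_contDiffAt hf)
    (differentiableAt_fderiv_of_contDiffAt hg)]
  simp only [add_apply]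
  ring

/-- The chain rule applied twice. Derivatives of `ψ` are taken over `ℂ`, so the first-order
correction term involves a complex bilinear second derivative. -/
theorem fderiv_fderiv_comp_holomorphic {F : E' → ℂ} {ψ : E → E'} {z : E}
    (hF : ContDiffAt ℝ 2 F (ψ z)) (hψ : ContDiffAt ℂ 2 ψ z) (u v : E) :
    fderiv ℝ (fderiv ℝ (fun y => F (ψ y))) z u v =
      fderiv ℝ (fderiv ℝ F) (ψ z) (fderiv ℂ ψ z u) (fderiv ℂ ψ z v)
        + fderiv ℝ F (ψ z) (fderiv ℂ (fderiv ℂ ψ) z u v) := by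
  have hψR : ContDiffAt ℝ 2 ψ z := hψ.restrict_scalars ℝ
  have hcomp : ContDiffAt ℝ 2 (fun y => F (ψ y)) z := hF.comp z hψR
  have hev : (fun y => fderiv ℝ (fun y => F (ψ y)) y v) =ᶠ[nhds z]
      fun y => fderiv ℝ F (ψ y) (fderiv ℂ ψ y v) := by
    filter_upwards [hψ.eventually (by simp),
      hψR.continuousAt.eventually (hF.eventually (by simp))] with y h1 h2
    have h1' := (h1.differentiableAt two_ne_zero).hasFDerivAt.restrictScalars ℝ
    have := (h2.differentiableAt two_ne_zero).hasFDerivAt.comp y h1'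
    have e : fderiv ℝ (fun y => F (ψ y)) y = _ := this.fderiv
    rw [e]
    rfl
  have hdψ : DifferentiableAt ℂ (fderiv ℂ ψ) z :=
    (hψ.fderiv_right (m := 1) le_rfl).differentiableAt one_ne_zero
  have h2 : HasFDerivAt (fun y => fderiv ℂ ψ y v)
      (((fderiv ℂ (fderiv ℂ ψ) z).flip v).restrictScalars ℝ) z := by
    refine HasFDerivAt.restrictScalars ℝ ?_
    have := hdψ.hasFDerivAt.clm_apply (hasFDerivAt_const v z)
    simpa using this
  have h1 : HasFDerivAt (fun y => fderiv ℝ F (ψ y))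
      ((fderiv ℝ (fderiv ℝ F) (ψ z)).comp ((fderiv ℂ ψ z).restrictScalars ℝ)) z :=
    (differentiableAt_fderiv_of_contDiffAt hF).hasFDerivAt.comp z
      ((hψ.differentiableAt two_ne_zero).hasFDerivAt.restrictScalars ℝ)
  have h3 := (h1.clm_apply h2).congr_of_eventuallyEq hev
  have h4 : HasFDerivAt (fun y => fderiv ℝ (fun y => F (ψ y)) y v)
      ((fderiv ℝ (fderiv ℝ (fun y => F (ψ y))) z).flip v) z := by
    have := (differentiableAt_fderiv_of_contDiffAt hcomp).hasFDerivAt.clm_apply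
      (hasFDerivAt_const v z)
    simpa using this
  have h5 := DFunLike.congr_fun (h4.unique h3) u
  simp only [ContinuousLinearMap.flip_apply, add_apply,
    ContinuousLinearMap.comp_apply, ContinuousLinearMap.coe_restrictScalars'] at h5
  rw [h5, add_comm]

/-- The complex Hessian is natural with respect to holomorphic maps. -/
theorem leviForm_comp_holomorphic {F : E' → ℂ} {ψ : E → E'} {z : E}
    (hF : ContDiffAt ℝ 2 F (ψ z)) (hψ : ContDiffAt ℂ 2 ψ z) (u v : E) :
    leviForm (fun y => F (ψ y)) z u v =
      leviForm F (ψ z) (fderiv ℂ ψ z u) (fderiv ℂ ψ z v) := by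
  -- Once `I` is pulled out of the complex bilinear second derivative of `ψ`, the four correction
  -- terms cancel.
  simp only [leviForm_apply, fderiv_fderiv_comp_holomorphic hF hψ, map_smul,
    smul_apply, smul_smul, Complex.I_mul_I, neg_one_smul, map_neg]
  ring

/-- The logarithm of the squared modulus of a nowhere vanishing holomorphic function is
pluriharmonic. -/
theorem leviForm_log_norm_sq {c : E → ℂ} {z : E} (hc : ContDiffAt ℂ 2 c z) (h0 : c z ≠ 0) :
    leviForm (fun y => ((Real.log (‖c y‖ ^ 2) : ℝ) : ℂ)) z = 0 := by
  -- Near `z`, `log |c|²` is `2 Re log (c / c z)` plus a constant: a real-affine function of a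
  -- holomorphic one. Dividing by `c z` moves the value to `1`, away from the branch cut.
  set Lre : ℂ →L[ℝ] ℂ := (2 : ℝ) • Complex.ofRealCLM.comp Complex.reCLM with hLre
  set F : ℂ → ℂ := fun w => Lre w + (Real.log (‖c z‖ ^ 2) : ℝ) with hF
  set ψ : E → ℂ := fun y => Complex.log (c y / c z) with hψ
  have hslit : c z / c z ∈ Complex.slitPlane := by
    rw [div_self h0]; exact Complex.one_mem_slitPlane
  have hψd : ContDiffAt ℂ 2 ψ z :=
    ContDiffAt.comp (g := Complex.log) (f := fun y => c y / c z) z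
      (Complex.contDiffAt_log hslit) (hc.div_const (c z))
  have hev : (fun y => ((Real.log (‖c y‖ ^ 2) : ℝ) : ℂ)) =ᶠ[nhds z] fun y => F (ψ y) := by
    filter_upwards [hc.continuousAt.eventually_ne h0] with y hy
    simp only [hF, hψ, hLre, smul_apply, ContinuousLinearMap.comp_apply,
      Complex.reCLM_apply, Complex.ofRealCLM_apply, Complex.log_re, norm_div, Complex.real_smul]
    rw [Real.log_div (norm_ne_zero_iff.2 hy) (norm_ne_zero_iff.2 h0), Real.log_pow, Real.log_pow]
    push_cast
    ring
  have hFd : fderiv ℝ F = fun _ => Lre := by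
    funext w
    exact (Lre.hasFDerivAt.add_const _).fderiv
  have hFc : ContDiff ℝ 2 F := Lre.contDiff.add contDiff_const
  rw [leviForm_congr hev]
  ext u v
  rw [leviForm_comp_holomorphic hFc.contDiffAt hψd, leviForm_apply, hFd]
  simp

end LeviForm

/-! ### Wirtinger derivatives and the complex Hessian -/

theorem dz_dzbar_eq_leviForm {n : ℕ} {f : Cn n → ℂ} {z : Cn n} (hf : ContDiffAt ℝ 2 f z)
    (i j : Fin n) : dz i (dzbar j f) z = leviForm f z (stdVec i) (stdVec j) := by
  have hd := differentiableAt_fderiv_of_contDiffAt hf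
  have h (v : Cn n) : HasFDerivAt (fun y => fderiv ℝ f y v)
      ((fderiv ℝ (fderiv ℝ f) z).flip v) z := by
    have := hd.hasFDerivAt.clm_apply (hasFDerivAt_const v z)
    simpa using this
  have h2 : HasFDerivAt (dzbar j f) ((1 / 2 : ℂ) • ((fderiv ℝ (fderiv ℝ f) z).flip (stdVec j)
      + Complex.I • (fderiv ℝ (fderiv ℝ f) z).flip (Complex.I • stdVec j))) z := by
    have := ((h (stdVec j)).add ((h (Complex.I • stdVec j)).const_smul Complex.I)).const_smul
      (1 / 2 : ℂ)
    refine this.congr_of_eventuallyEq (Filter.Eventually.of_forall fun y => ?_)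
    simp only [dzbar, Pi.smul_apply, Pi.add_apply, smul_eq_mul]
    ring
  rw [dz, h2.fderiv, leviForm_apply]
  simp only [smul_apply, add_apply,
    ContinuousLinearMap.flip_apply, smul_eq_mul]
  linear_combination (-(1 / 4 : ℂ) * fderiv ℝ (fderiv ℝ f) z (Complex.I • stdVec i)
    (Complex.I • stdVec j)) * Complex.I_mul_I

theorem contDiffAt_dz {n : ℕ} {f : Cn n → ℂ} {z : Cn n} (hf : ContDiffAt ℝ ∞ f z) (i : Fin n) :
    ContDiffAt ℝ ∞ (dz i f) z := by
  have h : ContDiffAt ℝ ∞ (fderiv ℝ f) z := hf.fderiv_right (by simp)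
  exact ((h.clm_apply contDiffAt_const).sub
    (contDiffAt_const.mul (h.clm_apply contDiffAt_const))).div_const 2

theorem contDiffAt_dzbar {n : ℕ} {f : Cn n → ℂ} {z : Cn n} (hf : ContDiffAt ℝ ∞ f z)
    (i : Fin n) : ContDiffAt ℝ ∞ (dzbar i f) z := by
  have h : ContDiffAt ℝ ∞ (fderiv ℝ f) z := hf.fderiv_right (by simp)
  exact ((h.clm_apply contDiffAt_const).add
    (contDiffAt_const.mul (h.clm_apply contDiffAt_const))).div_const 2

section Manifold

variable {n : ℕ} {X : Type*} [TopologicalSpace X] [ChartedSpace (Cn n) X]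

/-! ### Charts of a complex manifold -/

theorem contDiffOn_transition [IsManifold 𝓘(ℂ, Cn n) ω X]
    {φ φ' : OpenPartialHomeomorph X (Cn n)} (hφ : φ ∈ atlas (Cn n) X)
    (hφ' : φ' ∈ atlas (Cn n) X) : ContDiffOn ℂ ω (φ' ∘ φ.symm) (φ.symm ≫ₕ φ').source := by
  rw [← contMDiffOn_iff_contDiffOn, OpenPartialHomeomorph.trans_source]
  exact (contMDiffOn_of_mem_maximalAtlas (IsManifold.subset_maximalAtlas hφ')).comp'
    (contMDiffOn_symm_of_mem_maximalAtlas (IsManifold.subset_maximalAtlas hφ))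

/-- Metrics are smooth in the real sense, so inverse charts must be available as smooth maps over
`ℝ`; holomorphic transition maps are real smooth. -/
theorem isManifold_real (n : ℕ) (X : Type*) [TopologicalSpace X] [ChartedSpace (Cn n) X]
    [IsManifold 𝓘(ℂ, Cn n) ω X] : IsManifold 𝓘(ℝ, Cn n) ∞ X := by
  refine isManifold_of_contDiffOn _ _ _ fun e e' he he' => ?_
  have h := ((contDiffOn_transition he he').restrict_scalars ℝ).of_le
    (show (∞ : WithTop ℕ∞) ≤ ω from le_top)
  simpa using h

theorem contDiffAt_transition [IsManifold 𝓘(ℂ, Cn n) ω X]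
    {φ φ' : OpenPartialHomeomorph X (Cn n)} (hφ : φ ∈ atlas (Cn n) X)
    (hφ' : φ' ∈ atlas (Cn n) X) {x : X} (hx : x ∈ φ.source) (hx' : x ∈ φ'.source) :
    ContDiffAt ℂ ω (fun z => φ' (φ.symm z)) (φ x) := by
  refine (contDiffOn_transition hφ hφ').contDiffAt ((φ.symm ≫ₕ φ').open_source.mem_nhds ?_)
  simp [hx, hx']

theorem mfderiv_chart_symm_apply [IsManifold 𝓘(ℂ, Cn n) ω X]
    {φ : OpenPartialHomeomorph X (Cn n)} (hφ : φ ∈ atlas (Cn n) X) {z : Cn n}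
    (hz : z ∈ φ.target) (v : Cn n) :
    mfderiv 𝓘(ℂ, Cn n) 𝓘(ℂ, Cn n) φ (φ.symm z)
      (mfderiv 𝓘(ℂ, Cn n) 𝓘(ℂ, Cn n) φ.symm z v) = v := by
  have : IsManifold 𝓘(ℂ, Cn n) 1 X := .of_le (n := ω) le_top
  have h := (mdifferentiable_of_mem_atlas (I := 𝓘(ℂ, Cn n)) hφ).comp_symm_deriv hz
  exact DFunLike.congr_fun h v

theorem mfderiv_chart_change [IsManifold 𝓘(ℂ, Cn n) ω X]
    {φ φ' : OpenPartialHomeomorph X (Cn n)} (hφ : φ ∈ atlas (Cn n) X)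
    (hφ' : φ' ∈ atlas (Cn n) X) {x : X} (hx : x ∈ φ.source) (hx' : x ∈ φ'.source)
    (u : HolTangent n x) :
    mfderiv 𝓘(ℂ, Cn n) 𝓘(ℂ, Cn n) φ' x u =
      fderiv ℂ (fun z => φ' (φ.symm z)) (φ x) (mfderiv 𝓘(ℂ, Cn n) 𝓘(ℂ, Cn n) φ x u) := by
  have : IsManifold 𝓘(ℂ, Cn n) 1 X := .of_le (n := ω) le_top
  have hd := (contDiffAt_transition hφ hφ' hx hx').differentiableAt (by simp)
  have h1 : MDifferentiableAt 𝓘(ℂ, Cn n) 𝓘(ℂ, Cn n) φ x :=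
    mdifferentiableAt_atlas hφ hx
  have h2 := mfderiv_comp x hd.mdifferentiableAt h1
  have hev : (fun z => φ' (φ.symm z)) ∘ φ =ᶠ[nhds x] φ' := by
    filter_upwards [φ.open_source.mem_nhds hx] with y hy
    simp [φ.left_inv hy]
  rw [hev.mfderiv_eq, mfderiv_eq_fderiv] at h2
  exact DFunLike.congr_fun h2 u

/-! ### Sesquilinear forms in coordinates -/

theorem sesq_apply_linearMap {V : Type*} [AddCommGroup V] [Module ℂ V]
    (α : V →ₗ[ℂ] V →ₗ⋆[ℂ] ℂ) (T : Cn n →ₗ[ℂ] V) (c d : Cn n) :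
    α (T c) (T d) = ∑ i, ∑ j, α (T (stdVec i)) (T (stdVec j)) * (c i * conj (d j)) := by
  have h (c : Cn n) : T c = ∑ i, c i • T (stdVec i) := by
    have hc : c = ∑ i, c i • stdVec i := by
      ext j; simp [Pi.single_apply]
    conv_lhs => rw [hc, map_sum]
    simp only [map_smul]
  rw [h c, h d]
  exact sesq_apply_sum α (fun i => T (stdVec i)) c d

/-- The Gram matrix of a field of forms in a chart, evaluated on vectors with constant
coordinates. -/
theorem SesqField.apply_mfderiv_symm (α : SesqField n X) (φ : OpenPartialHomeomorph X (Cn n))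
    (z c d : Cn n) :
    α (φ.symm z) (mfderiv 𝓘(ℂ, Cn n) 𝓘(ℂ, Cn n) φ.symm z c)
      (mfderiv 𝓘(ℂ, Cn n) 𝓘(ℂ, Cn n) φ.symm z d) =
      ∑ i, ∑ j, α.coeff φ i j z * (c i * conj (d j)) := by
  let T : Cn n →ₗ[ℂ] HolTangent n (φ.symm z) :=
    (mfderiv 𝓘(ℂ, Cn n) 𝓘(ℂ, Cn n) φ.symm z).toLinearMap
  exact sesq_apply_linearMap (α (φ.symm z)) T c d

/-! ### The Chern curvature in charts and frames -/

variable {L : X → Type*} [∀ x, AddCommGroup (L x)] [∀ x, Module ℂ (L x)]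
  [∀ x, TopologicalSpace (L x)] [TopologicalSpace (TotalSpace ℂ L)] [FiberBundle ℂ L]

namespace HermitianMetric

theorem curvatureIn_apply (h : HermitianMetric n L) {φ : OpenPartialHomeomorph X (Cn n)}
    {e : Trivialization ℂ (TotalSpace.proj : TotalSpace ℂ L → X)} {x : X}
    (hs : ContDiffAt ℝ 2 (h.logNormSq φ e) (φ x)) (u v : HolTangent n x) :
    h.curvatureIn φ e x u v = -leviForm (h.logNormSq φ e) (φ x)
      (mfderiv 𝓘(ℂ, Cn n) 𝓘(ℂ, Cn n) φ x u) (mfderiv 𝓘(ℂ, Cn n) 𝓘(ℂ, Cn n) φ x v) := by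
  have h1 : h.curvatureIn φ e x u v = ∑ i, ∑ j,
      h.curvatureCoeff φ e i j (φ x) * (coordAt φ x i u * conj (coordAt φ x j v)) := rfl
  have h2 := sesq_apply_linearMap (leviForm (h.logNormSq φ e) (φ x)) LinearMap.id
    (mfderiv 𝓘(ℂ, Cn n) 𝓘(ℂ, Cn n) φ x u) (mfderiv 𝓘(ℂ, Cn n) 𝓘(ℂ, Cn n) φ x v)
  refine h1.trans (Eq.trans ?_ (congrArg Neg.neg h2.symm))
  rw [← Finset.sum_neg_distrib]
  refine Finset.sum_congr rfl fun i _ => ?_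
  rw [← Finset.sum_neg_distrib]
  refine Finset.sum_congr rfl fun j _ => ?_
  rw [curvatureCoeff, dz_dzbar_eq_leviForm hs, neg_mul]
  rfl

variable [VectorBundle ℂ ℂ L]

theorem symm_one_ne_zero (e : Trivialization ℂ (TotalSpace.proj : TotalSpace ℂ L → X))
    [MemTrivializationAtlas e] {x : X} (hx : x ∈ e.baseSet) : e.symm x 1 ≠ 0 := by
  intro h
  have h1 := e.linearMapAt_symm (R := ℂ) hx (1 : ℂ)
  rw [h, map_zero] at h1
  exact zero_ne_one h1

theorem contDiffAt_logNormSq [IsManifold 𝓘(ℂ, Cn n) ω X] (h : HermitianMetric n L)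
    {φ : OpenPartialHomeomorph X (Cn n)} (hφ : φ ∈ atlas (Cn n) X)
    (e : Trivialization ℂ (TotalSpace.proj : TotalSpace ℂ L → X)) [MemTrivializationAtlas e]
    {z : Cn n} (hz : z ∈ φ.target) (hze : φ.symm z ∈ e.baseSet) :
    ContDiffAt ℝ ∞ (h.logNormSq φ e) z := by
  have := isManifold_real n X
  have h1 := (h.smooth e).contMDiffAt (e.open_baseSet.mem_nhds hze)
  have h2 : ContMDiffAt 𝓘(ℝ, Cn n) 𝓘(ℝ, Cn n) ∞ φ.symm z :=
    contMDiffAt_symm_of_mem_maximalAtlas (IsManifold.subset_maximalAtlas hφ) hz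
  have h3 := (h1.comp z h2).contDiffAt
  exact Complex.ofRealCLM.contDiff.contDiffAt.comp z
    (h3.log (h.pos _ _ (symm_one_ne_zero e hze)).ne')

variable [ContMDiffVectorBundle ω ℂ L 𝓘(ℂ, Cn n)]

/-- The transition function of two trivializations of a holomorphic line bundle. -/
theorem exists_transition [IsManifold 𝓘(ℂ, Cn n) ω X]
    {φ : OpenPartialHomeomorph X (Cn n)} (hφ : φ ∈ atlas (Cn n) X)
    (e e' : Trivialization ℂ (TotalSpace.proj : TotalSpace ℂ L → X)) [MemTrivializationAtlas e]
    [MemTrivializationAtlas e'] {z : Cn n} (hz : z ∈ φ.target) (hze : φ.symm z ∈ e.baseSet)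
    (hze' : φ.symm z ∈ e'.baseSet) :
    ∃ c : Cn n → ℂ, ContDiffAt ℂ ω c z ∧
      (∀ y, φ.symm y ∈ e.baseSet → φ.symm y ∈ e'.baseSet →
        c y ≠ 0 ∧ e'.symm (φ.symm y) 1 = c y • e.symm (φ.symm y) 1) := by
  -- A linear coordinate change of `ℂ` is multiplication by its value at `1`.
  refine ⟨fun y => (e'.coordChangeL ℂ e (φ.symm y) : ℂ →L[ℂ] ℂ) 1, ?_, fun y hy hy' => ⟨?_, ?_⟩⟩
  · have h1 := (contMDiffOn_coordChangeL (n := ω) (IB := 𝓘(ℂ, Cn n)) e' e).contMDiffAt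
      ((e'.open_baseSet.inter e.open_baseSet).mem_nhds ⟨hze', hze⟩)
    have h2 : ContMDiffAt 𝓘(ℂ, Cn n) 𝓘(ℂ, Cn n) ω φ.symm z :=
      contMDiffAt_symm_of_mem_maximalAtlas (IsManifold.subset_maximalAtlas hφ) hz
    have h3 := (h1.comp z h2).contDiffAt
    exact h3.clm_apply contDiffAt_const
  · exact fun h0 => one_ne_zero ((e'.coordChangeL ℂ e (φ.symm y)).map_eq_zero_iff.1 h0)
  · have h1 := e'.coordChangeL_apply (R := ℂ) e ⟨hy', hy⟩ (1 : ℂ)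
    have h2 : e.symm (φ.symm y) (e'.coordChangeL ℂ e (φ.symm y) 1) = e'.symm (φ.symm y) 1 := by
      rw [h1]
      exact e.symm_apply_apply_mk hy _
    rw [← h2, ← e.symmₗ_apply (R := ℂ) hy, ← e.symmₗ_apply (R := ℂ) hy, ← map_smul, smul_eq_mul,
      mul_one]
    rfl

/-- The Chern curvature does not depend on the chart and the frame. -/
theorem curvatureIn_eq [IsManifold 𝓘(ℂ, Cn n) ω X] (h : HermitianMetric n L)
    {φ φ' : OpenPartialHomeomorph X (Cn n)} (hφ : φ ∈ atlas (Cn n) X)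
    (hφ' : φ' ∈ atlas (Cn n) X)
    (e e' : Trivialization ℂ (TotalSpace.proj : TotalSpace ℂ L → X)) [MemTrivializationAtlas e]
    [MemTrivializationAtlas e'] {x : X} (hx : x ∈ φ.source) (hx' : x ∈ φ'.source)
    (he : x ∈ e.baseSet) (he' : x ∈ e'.baseSet) :
    h.curvatureIn φ' e' x = h.curvatureIn φ e x := by
  have hz : φ x ∈ φ.target := φ.map_source hx
  have hsx : φ.symm (φ x) = x := φ.left_inv hx
  have hF : ContDiffAt ℝ 2 (h.logNormSq φ e) (φ x) :=
    (h.contDiffAt_logNormSq hφ e hz (by rwa [hsx])).of_le ENat.LEInfty.out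
  have hF' : ContDiffAt ℝ 2 (h.logNormSq φ' e') (φ' x) :=
    (h.contDiffAt_logNormSq hφ' e' (φ'.map_source hx')
      (by rwa [φ'.left_inv hx'])).of_le ENat.LEInfty.out
  obtain ⟨c, hc, hce⟩ := exists_transition (n := n) hφ e e' hz (by rwa [hsx]) (by rwa [hsx])
  have hc0 : c (φ x) ≠ 0 := (hce (φ x) (by rwa [hsx]) (by rwa [hsx])).1
  have hc2 : ContDiffAt ℂ 2 c (φ x) := hc.of_le le_top
  have hlog : ContDiffAt ℝ 2 (fun y => ((Real.log (‖c y‖ ^ 2) : ℝ) : ℂ)) (φ x) := by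
    have h1 : ContDiffAt ℝ 2 c (φ x) := hc2.restrict_scalars ℝ
    have h2 : ContDiffAt ℝ 2 (fun y => ‖c y‖ ^ 2) (φ x) := h1.norm_sq ℝ
    exact Complex.ofRealCLM.contDiff.contDiffAt.comp (φ x) (h2.log (by simpa using hc0))
  have hψ := contDiffAt_transition hφ hφ' hx hx'
  -- The frames differ by the factor `c`, so the log norms differ by `log |c|²`, whose complex
  -- Hessian vanishes.
  have hev : (fun y => h.logNormSq φ' e' (φ' (φ.symm y))) =ᶠ[nhds (φ x)]
      fun y => h.logNormSq φ e y + ((Real.log (‖c y‖ ^ 2) : ℝ) : ℂ) := by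
    have hcont : ContinuousAt φ.symm (φ x) := φ.continuousAt_symm hz
    filter_upwards [hcont.eventually (e.open_baseSet.mem_nhds (by rwa [hsx])),
      hcont.eventually (e'.open_baseSet.mem_nhds (by rwa [hsx])),
      hcont.eventually (φ'.open_source.mem_nhds (by rwa [hsx]))] with y hy hy' hyφ
    obtain ⟨hy0, hys⟩ := hce y hy hy'
    simp only [logNormSq]
    rw [φ'.left_inv hyφ, hys, ← Complex.ofReal_add]
    congr 1
    have hp := h.pos _ _ (symm_one_ne_zero e hy)
    have hq : h.inner _ (c y • e.symm (φ.symm y) 1) (c y • e.symm (φ.symm y) 1) =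
        ((‖c y‖ ^ 2 : ℝ) : ℂ) * h.inner _ (e.symm (φ.symm y) 1) (e.symm (φ.symm y) 1) := by
      simp only [map_smul, LinearMap.smul_apply, LinearMap.map_smulₛₗ, smul_eq_mul]
      rw [Complex.ofReal_pow, ← Complex.conj_mul']
      ring
    rw [hq, Complex.re_ofReal_mul, Real.log_mul (by simpa using hy0) hp.ne', add_comm]
  ext u v
  rw [h.curvatureIn_apply hF', h.curvatureIn_apply hF, mfderiv_chart_change hφ hφ' hx hx',
    mfderiv_chart_change hφ hφ' hx hx']
  have hF'' : ContDiffAt ℝ 2 (h.logNormSq φ' e') (φ' (φ.symm (φ x))) := by rwa [hsx]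
  have key := leviForm_comp_holomorphic (ψ := fun z => φ' (φ.symm z)) hF''
    (hψ.of_le le_top) (mfderiv 𝓘(ℂ, Cn n) 𝓘(ℂ, Cn n) φ x u)
    (mfderiv 𝓘(ℂ, Cn n) 𝓘(ℂ, Cn n) φ x v)
  rw [leviForm_congr hev, leviForm_add hF hlog, leviForm_log_norm_sq hc2 hc0, add_zero, hsx] at key
  rw [key]

/-- The coefficients of the Chern curvature are smooth in every chart. -/
theorem contDiffOn_coeff_chernCurvature [IsManifold 𝓘(ℂ, Cn n) ω X] (h : HermitianMetric n L)
    {φ : OpenPartialHomeomorph X (Cn n)} (hφ : φ ∈ atlas (Cn n) X) (i j : Fin n) :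
    ContDiffOn ℝ ∞ (h.chernCurvature.coeff φ i j) φ.target := by
  intro z hz
  refine ContDiffAt.contDiffWithinAt ?_
  -- Chart and frame are frozen near `z`; independence of the choices then gives one smooth formula
  -- on a neighbourhood.
  set e := trivializationAt ℂ L (φ.symm z) with he
  have hze : φ.symm z ∈ e.baseSet := FiberBundle.mem_baseSet_trivializationAt ℂ L _
  have hs := h.contDiffAt_logNormSq hφ e hz hze
  have hcoef : ContDiffAt ℝ ∞ (h.curvatureCoeff φ e i j) z := (contDiffAt_dz (contDiffAt_dzbar hs j) i).neg
  refine hcoef.congr_of_eventuallyEq ?_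
  filter_upwards [φ.open_target.mem_nhds hz,
    (φ.continuousAt_symm hz).eventually (e.open_baseSet.mem_nhds hze)] with y hy hye
  have hsy := h.contDiffAt_logNormSq hφ e hy hye
  have hxs : φ.symm y ∈ φ.source := φ.map_target hy
  have hry : φ (φ.symm y) = y := φ.right_inv hy
  have hsy2 : ContDiffAt ℝ 2 (h.logNormSq φ e) (φ (φ.symm y)) := by
    rw [hry]
    exact hsy.of_le ENat.LEInfty.out
  rw [SesqField.coeff, chernCurvature, h.curvatureIn_eq hφ (chart_mem_atlas _ _) e _ hxs
    (mem_chart_source _ _) hye (FiberBundle.mem_baseSet_trivializationAt ℂ L _),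
    h.curvatureIn_apply hsy2, mfderiv_chart_symm_apply hφ hy, mfderiv_chart_symm_apply hφ hy,
    hry, curvatureCoeff, dz_dzbar_eq_leviForm (by rwa [hry] at hsy2)]

end HermitianMetric

end Manifold

/-! ### Uniform inequalities over a compact set -/

/-- With `ε` as an extra variable, the strict inequality holds at `(0, y₀)` for all `c ∈ K`. By
compactness it persists for `(ε, y)` nearby, in particular for some `ε > 0`. -/
theorem exists_pos_eventually_mul_lt {Y Z : Type*} [TopologicalSpace Y] [TopologicalSpace Z]
    {P Q : Y → Z → ℝ} {y₀ : Y} {K : Set Z} (hK : IsCompact K)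
    (hP : ∀ c ∈ K, ContinuousAt (Function.uncurry P) (y₀, c))
    (hQ : ∀ c ∈ K, ContinuousAt (Function.uncurry Q) (y₀, c))
    (hpos : ∀ c ∈ K, 0 < P y₀ c) :
    ∃ ε > 0, ∀ᶠ y in nhds y₀, ∀ c ∈ K, ε * Q y c < P y c := by
  have h : ∀ᶠ p : ℝ × Y in nhds (0, y₀), ∀ c ∈ K, p.1 * Q p.2 c < P p.2 c := by
    refine hK.eventually_forall_of_forall_eventually (x₀ := ((0 : ℝ), y₀))
      (P := fun p c => p.1 * Q p.2 c < P p.2 c) fun c hc => ?_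
    have hπ : ContinuousAt (fun r : (ℝ × Y) × Z => (r.1.2, r.2)) (((0 : ℝ), y₀), c) := by
      fun_prop
    have h1 : ContinuousAt (fun r : (ℝ × Y) × Z => P r.1.2 r.2) (((0 : ℝ), y₀), c) :=
      ContinuousAt.comp (f := fun r : (ℝ × Y) × Z => (r.1.2, r.2)) (g := Function.uncurry P)
        (hP c hc) hπ
    have h2 : ContinuousAt (fun r : (ℝ × Y) × Z => Q r.1.2 r.2) (((0 : ℝ), y₀), c) :=
      ContinuousAt.comp (f := fun r : (ℝ × Y) × Z => (r.1.2, r.2)) (g := Function.uncurry Q)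
        (hQ c hc) hπ
    have h3 : ContinuousAt (fun r : (ℝ × Y) × Z => r.1.1) (((0 : ℝ), y₀), c) := by fun_prop
    exact (h3.mul h2).eventually_lt h1 (by simpa using hpos c hc)
  have h4 : ∀ᶠ ε in nhds (0 : ℝ), ∀ᶠ y in nhds y₀, ∀ c ∈ K, ε * Q y c < P y c :=
    h.curry_nhds
  obtain ⟨ε, h5, h6⟩ :=
    ((h4.filter_mono nhdsWithin_le_nhds).and (self_mem_nhdsWithin (s := Set.Ioi 0))).exists
  exact ⟨ε, h6, h5⟩

section Manifold

variable {n : ℕ} {X : Type*} [TopologicalSpace X] [ChartedSpace (Cn n) X]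

theorem mfderiv_chart_symm_bijective [IsManifold 𝓘(ℂ, Cn n) ω X]
    {φ : OpenPartialHomeomorph X (Cn n)} (hφ : φ ∈ atlas (Cn n) X) {z : Cn n}
    (hz : z ∈ φ.target) :
    Function.Bijective (mfderiv 𝓘(ℂ, Cn n) 𝓘(ℂ, Cn n) φ.symm z) := by
  have : IsManifold 𝓘(ℂ, Cn n) 1 X := .of_le (n := ω) le_top
  exact (mdifferentiable_of_mem_atlas (I := 𝓘(ℂ, Cn n)) hφ).symm.mfderiv_bijective hz

theorem finrank_holTangent (x : X) : Module.finrank ℂ (HolTangent n x) = n :=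
  finrank_euclideanSpace_fin

/-! ### Uniform bounds on the eigenvalues -/

/-- At `x`, the form `α` is larger than `δ g` on a `k`-dimensional subspace and bounded by
`R g`. -/
def BoundedAt (g α : SesqField n X) (k : ℕ) (δ R : ℝ) (x : X) : Prop :=
  (∃ W : Submodule ℂ (HolTangent n x), k ≤ Module.finrank ℂ W ∧
    ∀ v ∈ W, v ≠ 0 → δ * (g x v v).re < (α x v v).re) ∧
  ∀ v, v ≠ 0 → |(α x v v).re| ≤ R * (g x v v).re

theorem BoundedAt.mono {g : HermitianForm n X} {α : SesqField n X} {k : ℕ} {δ δ' R R' : ℝ} {x : X}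
    (h : BoundedAt g.form α k δ R x) (hδ : δ' ≤ δ) (hR : R ≤ R') :
    BoundedAt g.form α k δ' R' x := by
  obtain ⟨⟨W, hW, hWv⟩, hb⟩ := h
  refine ⟨⟨W, hW, fun v hv hv0 => lt_of_le_of_lt ?_ (hWv v hv hv0)⟩,
    fun v hv0 => (hb v hv0).trans ?_⟩
  · exact mul_le_mul_of_nonneg_right hδ (g.pos x v hv0).le
  · exact mul_le_mul_of_nonneg_right hR (g.pos x v hv0).le

theorem sesq_smul_self_re {V : Type*} [AddCommGroup V] [Module ℂ V]
    (α : V →ₗ[ℂ] V →ₗ⋆[ℂ] ℂ) (t : ℝ) (v : V) :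
    (α ((t : ℂ) • v) ((t : ℂ) • v)).re = t ^ 2 * (α v v).re := by
  simp only [map_smul, LinearMap.smul_apply, LinearMap.map_smulₛₗ, smul_eq_mul,
    Complex.conj_ofReal, Complex.re_ofReal_mul]
  ring

theorem SesqField.continuousAt_apply_mfderiv_symm {α : SesqField n X}
    {φ : OpenPartialHomeomorph X (Cn n)} {z : Cn n}
    (hα : ∀ i j, ContinuousAt (α.coeff φ i j) z) (c : Cn n) :
    ContinuousAt (Function.uncurry fun z c : Cn n =>
      (α (φ.symm z) (mfderiv 𝓘(ℂ, Cn n) 𝓘(ℂ, Cn n) φ.symm z c)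
        (mfderiv 𝓘(ℂ, Cn n) 𝓘(ℂ, Cn n) φ.symm z c)).re) (z, c) := by
  have e : (Function.uncurry fun z c : Cn n =>
      (α (φ.symm z) (mfderiv 𝓘(ℂ, Cn n) 𝓘(ℂ, Cn n) φ.symm z c)
        (mfderiv 𝓘(ℂ, Cn n) 𝓘(ℂ, Cn n) φ.symm z c)).re) =
      fun p : Cn n × Cn n => (∑ i, ∑ j, α.coeff φ i j p.1 * (p.2 i * conj (p.2 j))).re := by
    funext p
    exact congrArg Complex.re (α.apply_mfderiv_symm φ p.1 p.2 p.2)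
  rw [e]
  refine Complex.continuous_re.continuousAt.comp ?_
  refine tendsto_finsetSum _ fun i _ => tendsto_finsetSum _ fun j _ => ?_
  have h1 : ContinuousAt (fun p : Cn n × Cn n => α.coeff φ i j p.1) (z, c) :=
    ContinuousAt.comp (g := α.coeff φ i j) (hα i j) continuousAt_fst
  have h2 : Continuous fun p : Cn n × Cn n => p.2 i * conj (p.2 j) := by fun_prop
  exact h1.mul h2.continuousAt

/-- Through the derivative of the inverse chart all forms live on one fixed `ℂⁿ`. The positive
subspace at `z₀` is kept as `z` moves, and compactness of unit spheres gives uniform constants. -/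
theorem eventually_boundedAt_chart [IsManifold 𝓘(ℂ, Cn n) ω X] (g : HermitianForm n X)
    {α : SesqField n X} {φ : OpenPartialHomeomorph X (Cn n)} (hφ : φ ∈ atlas (Cn n) X)
    (hα : ∀ i j, ContDiffOn ℝ ∞ (α.coeff φ i j) φ.target) {q : ℕ} {z₀ : Cn n}
    (hz₀ : z₀ ∈ φ.target) (hq : HasPositiveEigenvalues n q (α (φ.symm z₀))) :
    ∃ δ > 0, ∃ R, ∀ᶠ z in nhds z₀, BoundedAt g.form α (n - q) δ R (φ.symm z) := by
  let T (z : Cn n) : Cn n →ₗ[ℂ] HolTangent n (φ.symm z) :=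
    (mfderiv 𝓘(ℂ, Cn n) 𝓘(ℂ, Cn n) φ.symm z).toLinearMap
  have hT (z : Cn n) (hz : z ∈ φ.target) : Function.Bijective (T z) :=
    mfderiv_chart_symm_bijective hφ hz
  have hαc := SesqField.continuousAt_apply_mfderiv_symm (z := z₀) fun i j =>
    (hα i j).continuousOn.continuousAt (φ.open_target.mem_nhds hz₀)
  have hgc := SesqField.continuousAt_apply_mfderiv_symm (z := z₀) fun i j =>
    (g.smooth φ hφ i j).continuousOn.continuousAt (φ.open_target.mem_nhds hz₀)
  obtain ⟨W, hWd, hW⟩ := hq.exists_submodule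
  set W₀ : Submodule ℂ (Cn n) := W.comap (T z₀) with hW₀
  have hW₀d : Module.finrank ℂ W₀ = Module.finrank ℂ W := by
    have hmap : W₀.map (T z₀) = W := Submodule.map_comap_eq_of_surjective (hT z₀ hz₀).2 W
    rw [(W₀.equivMapOfInjective (T z₀) (hT z₀ hz₀).1).finrank_eq, hmap]
  have hne (z : Cn n) (hz : z ∈ φ.target) (c : Cn n) (hc : c ≠ 0) : T z c ≠ 0 := fun h =>
    hc ((hT z hz).1 (h.trans (map_zero _).symm))
  have hsph (c : Cn n) (hc : c ∈ Metric.sphere (0 : Cn n) 1) : c ≠ 0 := by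
    rintro rfl
    simp at hc
  obtain ⟨δ, hδ, hδev⟩ := exists_pos_eventually_mul_lt
    (P := fun z c => (α (φ.symm z) (T z c) (T z c)).re)
    (Q := fun z c => (g.form (φ.symm z) (T z c) (T z c)).re)
    ((isCompact_sphere (0 : Cn n) 1).inter_right W₀.closed_of_finiteDimensional)
    (fun c _ => hαc c) (fun c _ => hgc c)
    (fun c hc => hW _ hc.2 (hne z₀ hz₀ c (hsph c hc.1)))
  -- Here `ε |α| < g` on the sphere, whence the upper bound `R = ε⁻¹`.
  obtain ⟨ε, hε, hεev⟩ := exists_pos_eventually_mul_lt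
    (P := fun z c => (g.form (φ.symm z) (T z c) (T z c)).re)
    (Q := fun z c => |(α (φ.symm z) (T z c) (T z c)).re|)
    (isCompact_sphere (0 : Cn n) 1) (fun c _ => hgc c) (fun c _ => (hαc c).abs)
    (fun c hc => g.pos _ _ (hne z₀ hz₀ c (hsph c hc)))
  refine ⟨δ, hδ, ε⁻¹, ?_⟩
  filter_upwards [hδev, hεev, φ.open_target.mem_nhds hz₀] with z h1 h2 hz
  have hscale (c : Cn n) (hc : c ≠ 0) : ∃ t : ℝ, 0 < t ∧ ∃ d ∈ Metric.sphere (0 : Cn n) 1,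
      c = (t : ℂ) • d := by
    have hc' : 0 < ‖c‖ := norm_pos_iff.2 hc
    refine ⟨‖c‖, hc', ((‖c‖⁻¹ : ℝ) : ℂ) • c, ?_, ?_⟩
    · rw [mem_sphere_zero_iff_norm, norm_smul, Complex.norm_real, norm_inv, norm_norm,
        inv_mul_cancel₀ hc'.ne']
    · rw [smul_smul, ← Complex.ofReal_mul, mul_inv_cancel₀ hc'.ne', Complex.ofReal_one, one_smul]
  refine ⟨⟨W₀.map (T z), ?_, ?_⟩, ?_⟩
  · rw [← (W₀.equivMapOfInjective (T z) (hT z hz).1).finrank_eq, hW₀d]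
    exact hWd
  · rintro _ ⟨c, hc, rfl⟩ hv0
    have hc0 : c ≠ 0 := by
      rintro rfl
      exact hv0 (map_zero _)
    obtain ⟨t, ht, d, hd, rfl⟩ := hscale c hc0
    have hdW : d ∈ W₀ := (W₀.smul_mem_iff (by exact_mod_cast ht.ne')).1 hc
    have := h1 d ⟨hd, hdW⟩
    rw [map_smul, sesq_smul_self_re, sesq_smul_self_re]
    have ht2 : 0 < t ^ 2 := by positivity
    nlinarith
  · intro v hv0
    obtain ⟨c, rfl⟩ := (hT z hz).2 v
    have hc0 : c ≠ 0 := by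
      rintro rfl
      exact hv0 (map_zero _)
    obtain ⟨t, ht, d, hd, rfl⟩ := hscale c hc0
    have := h2 d hd
    rw [map_smul, sesq_smul_self_re, sesq_smul_self_re, abs_mul, abs_of_pos (by positivity),
      mul_left_comm]
    refine mul_le_mul_of_nonneg_left ?_ (by positivity)
    rw [le_inv_mul_iff₀ hε]
    exact this.le

/-- Local constants are merged over a finite cover: the minimum of the `δ`'s and the maximum of the
`R`'s. -/
theorem exists_boundedAt [CompactSpace X] [IsManifold 𝓘(ℂ, Cn n) ω X] (g : HermitianForm n X)
    {α : SesqField n X}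
    (hα : ∀ φ ∈ atlas (Cn n) X, ∀ i j, ContDiffOn ℝ ∞ (α.coeff φ i j) φ.target) {q : ℕ}
    (hq : ∀ x, HasPositiveEigenvalues n q (α x)) :
    ∃ δ R : ℝ, 0 < δ ∧ δ ≤ R ∧ ∀ x, BoundedAt g.form α (n - q) δ R x := by
  have h : ∃ δ R : ℝ, 0 < δ ∧ δ ≤ R ∧ ∀ x ∈ Set.univ, BoundedAt g.form α (n - q) δ R x := by
    refine isCompact_univ.induction_on (p := fun s =>
      ∃ δ R : ℝ, 0 < δ ∧ δ ≤ R ∧ ∀ x ∈ s, BoundedAt g.form α (n - q) δ R x) ?_ ?_ ?_ ?_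
    · exact ⟨1, 1, one_pos, le_rfl, by simp⟩
    · rintro s t hst ⟨δ, R, hδ, hR, h⟩
      exact ⟨δ, R, hδ, hR, fun x hx => h x (hst hx)⟩
    · rintro s t ⟨δ, R, hδ, hR, h⟩ ⟨δ', R', hδ', hR', h'⟩
      refine ⟨min δ δ', max R R', lt_min hδ hδ',
        (min_le_left _ _).trans (hR.trans (le_max_left _ _)), ?_⟩
      rintro x (hx | hx)
      · exact (h x hx).mono (min_le_left _ _) (le_max_left _ _)
      · exact (h' x hx).mono (min_le_right _ _) (le_max_right _ _)
    · intro x _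
      obtain ⟨δ, hδ, R, hev⟩ := eventually_boundedAt_chart g (chart_mem_atlas (Cn n) x)
        (hα _ (chart_mem_atlas _ x)) (mem_chart_target (Cn n) x) (hq _)
      have hev' : ∀ᶠ y in nhds x, BoundedAt g.form α (n - q) δ R y := by
        filter_upwards [((chartAt (Cn n) x).continuousAt (mem_chart_source _ x)).eventually hev,
          (chartAt (Cn n) x).open_source.mem_nhds (mem_chart_source _ x)] with y hy hys
        rwa [(chartAt (Cn n) x).left_inv hys] at hy
      exact ⟨_, nhdsWithin_le_nhds hev', δ, max R δ, hδ, le_max_right _ _,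
        fun y hy => BoundedAt.mono hy le_rfl (le_max_left _ _)⟩
  obtain ⟨δ, R, hδ, hR, h⟩ := h
  exact ⟨δ, R, hδ, hR, fun x => h x trivial⟩

/-! ### Smoothness of the rescaled form -/

/-- The Gram matrix of a field of forms in a chart. -/
def SesqField.gram (α : SesqField n X) (φ : OpenPartialHomeomorph X (Cn n)) (z : Cn n) :
    Matrix (Fin n) (Fin n) ℂ :=
  Matrix.of fun i j => α.coeff φ i j z

theorem SesqField.apply_mfderiv_symm_stdVec (α : SesqField n X)
    (φ : OpenPartialHomeomorph X (Cn n)) (z c : Cn n) (j : Fin n) :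
    α (φ.symm z) (mfderiv 𝓘(ℂ, Cn n) 𝓘(ℂ, Cn n) φ.symm z c)
      (mfderiv 𝓘(ℂ, Cn n) 𝓘(ℂ, Cn n) φ.symm z (stdVec j)) =
      ∑ i, c i * α.coeff φ i j z := by
  rw [α.apply_mfderiv_symm]
  refine Finset.sum_congr rfl fun i _ => ?_
  rw [Finset.sum_eq_single j (fun k _ hk => by simp [hk]) (by simp)]
  simp [mul_comm]

/-- A null vector of the Gram matrix would give a nonzero tangent vector of length zero. -/
theorem HermitianForm.det_gram_ne_zero [IsManifold 𝓘(ℂ, Cn n) ω X] (g : HermitianForm n X)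
    {φ : OpenPartialHomeomorph X (Cn n)} (hφ : φ ∈ atlas (Cn n) X) {z : Cn n}
    (hz : z ∈ φ.target) : (g.form.gram φ z).det ≠ 0 := by
  intro h0
  obtain ⟨v, hv, hvG⟩ := Matrix.exists_vecMul_eq_zero_iff.2 h0
  set c : Cn n := WithLp.toLp 2 v with hc
  have hc0 : c ≠ 0 := by
    intro h
    exact hv (by simpa [hc] using h)
  have hTc : mfderiv 𝓘(ℂ, Cn n) 𝓘(ℂ, Cn n) φ.symm z c ≠ 0 := fun h =>
    hc0 ((mfderiv_chart_symm_bijective hφ hz).1 (h.trans (map_zero _).symm))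
  have hpos := g.pos _ _ hTc
  rw [g.form.apply_mfderiv_symm, Finset.sum_comm] at hpos
  have hj (j : Fin n) : ∑ i, g.form.coeff φ i j z * (c i * conj (c j)) = 0 := by
    have := congrFun hvG j
    simp only [Matrix.vecMul, dotProduct, SesqField.gram, Matrix.of_apply, Pi.zero_apply] at this
    calc _ = (∑ i, v i * g.form.coeff φ i j z) * conj (c j) := by
          rw [Finset.sum_mul]
          refine Finset.sum_congr rfl fun i _ => ?_
          simp only [hc]
          ring
      _ = 0 := by rw [this, zero_mul]
  simp [hj] at hpos

/-- If `α = g(A ·, ·)`, the Gram matrix of `β(A ·, ·)` is `α g⁻¹ β`. -/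
theorem gram_comp_endomorphism [IsManifold 𝓘(ℂ, Cn n) ω X] (g : HermitianForm n X)
    {α : SesqField n X} (β : SesqField n X) {A : ∀ x : X, HolTangent n x →ₗ[ℂ] HolTangent n x}
    (hA : ∀ x u v, α x u v = g.form x (A x u) v)
    {φ : OpenPartialHomeomorph X (Cn n)} (hφ : φ ∈ atlas (Cn n) X) {z : Cn n}
    (hz : z ∈ φ.target) :
    SesqField.gram (fun x => (β x).comp (A x)) φ z =
      α.gram φ z * (g.form.gram φ z)⁻¹ * β.gram φ z := by
  have hsurj := (mfderiv_chart_symm_bijective hφ hz).2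
  have hex (i : Fin n) : ∃ c : Cn n, mfderiv 𝓘(ℂ, Cn n) 𝓘(ℂ, Cn n) φ.symm z c =
      A (φ.symm z) (mfderiv 𝓘(ℂ, Cn n) 𝓘(ℂ, Cn n) φ.symm z (stdVec i)) := hsurj _
  choose c hc using hex
  -- Row `i` holds the coordinates of `A` applied to the `i`-th coordinate vector; hence `M = α g⁻¹`
  -- in terms of Gram matrices.
  set M : Matrix (Fin n) (Fin n) ℂ := Matrix.of fun i k => c i k with hM
  have h1 : α.gram φ z = M * g.form.gram φ z := by
    ext i j
    rw [Matrix.mul_apply]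
    refine Eq.trans ?_ (g.form.apply_mfderiv_symm_stdVec φ z (c i) j)
    rw [hc, ← hA]
    rfl
  have h2 : SesqField.gram (fun x => (β x).comp (A x)) φ z = M * β.gram φ z := by
    ext i j
    rw [Matrix.mul_apply]
    refine Eq.trans ?_ (β.apply_mfderiv_symm_stdVec φ z (c i) j)
    rw [hc]
    rfl
  have hdet : IsUnit (g.form.gram φ z).det := isUnit_iff_ne_zero.2 (g.det_gram_ne_zero hφ hz)
  rw [h1, h2, Matrix.mul_nonsing_inv_cancel_right _ _ hdet]

/-! ### Smooth dependence of determinants and inverses -/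

theorem ContDiffOn.matrix_det {E : Type*} [NormedAddCommGroup E] [NormedSpace ℝ E] {s : Set E}
    {G : E → Matrix (Fin n) (Fin n) ℂ} (hG : ∀ i j, ContDiffOn ℝ ∞ (fun z => G z i j) s) :
    ContDiffOn ℝ ∞ (fun z => (G z).det) s := by
  simp only [Matrix.det_apply']
  exact ContDiffOn.sum fun σ _ => contDiffOn_const.mul (contDiffOn_prod fun i _ => hG _ _)

/-- Cramer's rule: each adjugate entry is the determinant of the matrix with one row made constant.
-/
theorem ContDiffOn.matrix_inv_apply {E : Type*} [NormedAddCommGroup E] [NormedSpace ℝ E]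
    {s : Set E} {G : E → Matrix (Fin n) (Fin n) ℂ}
    (hG : ∀ i j, ContDiffOn ℝ ∞ (fun z => G z i j) s) (h0 : ∀ z ∈ s, (G z).det ≠ 0)
    (i j : Fin n) : ContDiffOn ℝ ∞ (fun z => (G z)⁻¹ i j) s := by
  simp only [Matrix.inv_def, Ring.inverse_eq_inv', Matrix.smul_apply, Matrix.adjugate_apply,
    smul_eq_mul]
  refine ((ContDiffOn.matrix_det hG).inv h0).mul (ContDiffOn.matrix_det fun k l => ?_)
  by_cases hk : k = j
  · subst hk
    simpa using contDiffOn_const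
  · simpa [Matrix.updateRow_apply, hk] using hG k l

theorem contDiffOn_coeff_comp_endomorphism [IsManifold 𝓘(ℂ, Cn n) ω X] (g : HermitianForm n X)
    {α β : SesqField n X} {A : ∀ x : X, HolTangent n x →ₗ[ℂ] HolTangent n x}
    (hA : ∀ x u v, α x u v = g.form x (A x u) v)
    {φ : OpenPartialHomeomorph X (Cn n)} (hφ : φ ∈ atlas (Cn n) X)
    (hα : ∀ i j, ContDiffOn ℝ ∞ (α.coeff φ i j) φ.target)
    (hβ : ∀ i j, ContDiffOn ℝ ∞ (β.coeff φ i j) φ.target) (i j : Fin n) :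
    ContDiffOn ℝ ∞ (SesqField.coeff (fun x => (β x).comp (A x)) φ i j) φ.target := by
  have hinv := ContDiffOn.matrix_inv_apply (G := g.form.gram φ) (g.smooth φ hφ)
    fun z hz => g.det_gram_ne_zero hφ hz
  have h : ContDiffOn ℝ ∞ (fun z => ∑ l, (∑ k, α.coeff φ i k z * (g.form.gram φ z)⁻¹ k l)
      * β.coeff φ l j z) φ.target :=
    ContDiffOn.sum fun l _ => (ContDiffOn.sum fun k _ => (hα i k).mul (hinv k l)).mul (hβ l j)
  refine h.congr fun z hz => ?_
  have := congrFun (congrFun (gram_comp_endomorphism g β hA hφ hz) i) j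
  simp only [Matrix.mul_apply] at this
  exact this

/-- Induction on `N`: if `β` is the form for `N`, the form for `N + 1` is `β - c β(A ·, ·)`. -/
theorem contDiffOn_coeff_comp_pow [IsManifold 𝓘(ℂ, Cn n) ω X] (g : HermitianForm n X)
    {α : SesqField n X} {A : ∀ x : X, HolTangent n x →ₗ[ℂ] HolTangent n x}
    (hA : ∀ x u v, α x u v = g.form x (A x u) v)
    {φ : OpenPartialHomeomorph X (Cn n)} (hφ : φ ∈ atlas (Cn n) X)
    (hα : ∀ i j, ContDiffOn ℝ ∞ (α.coeff φ i j) φ.target) (c : ℂ) (N : ℕ) (i j : Fin n) :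
    ContDiffOn ℝ ∞ (SesqField.coeff (fun x => (g.form x).comp ((1 - c • A x) ^ N)) φ i j)
      φ.target := by
  induction N generalizing i j with
  | zero => exact g.smooth φ hφ i j
  | succ N ih =>
    have h := contDiffOn_coeff_comp_endomorphism g hA hφ hα ih i j
    refine ((ih i j).sub ((contDiffOn_const (c := c)).mul h)).congr fun z _ => ?_
    simp only [SesqField.coeff, pow_succ, LinearMap.comp_apply, Module.End.mul_apply,
      LinearMap.sub_apply, Module.End.one_apply, LinearMap.smul_apply, map_sub, map_smul,
      smul_eq_mul]

/-! ### Subharmonicity with respect to the rescaled form -/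

/-- A smooth field of hermitian forms with at least `n - q` positive eigenvalues everywhere on a
compact complex manifold is `(ω, n - q)`-subharmonic for some positive hermitian form `ω`. -/
theorem exists_isSubharmonic [CompactSpace X] [IsManifold 𝓘(ℂ, Cn n) ω X] (g : HermitianForm n X)
    {α : SesqField n X}
    (hα : ∀ φ ∈ atlas (Cn n) X, ∀ i j, ContDiffOn ℝ ∞ (α.coeff φ i j) φ.target) {q : ℕ}
    (hq : ∀ x, HasPositiveEigenvalues n q (α x)) :
    ∃ g' : HermitianForm n X, IsSubharmonic α g' (n - q) := by
  obtain ⟨δ, R, hδ, hδR, hb⟩ := exists_boundedAt g hα hq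
  have hR : 0 < R := hδ.trans_le hδR
  obtain ⟨N, hN⟩ := exists_pow_sigma_pos n hδ hδR
  have hfin (x : X) : FiniteDimensional ℂ (HolTangent n x) :=
    inferInstanceAs (FiniteDimensional ℂ (Cn n))
  have hex (x : X) : ∃ lam : Fin n → ℝ, IsEigenvalueVector (g.form x) (α x) lam := by
    obtain ⟨g₁, lam₁, h₁, -⟩ := hq x
    exact exists_isEigenvalueVector (finrank_holTangent x) (g.conj_symm x) (g.pos x)
      h₁.conj_symm_right
  choose lam hlam using hex
  have hAex (x : X) : ∃ A : HolTangent n x →ₗ[ℂ] HolTangent n x,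
      ∀ u v, α x u v = g.form x (A u) v := by
    obtain ⟨b, hgb, -⟩ := hlam x
    exact exists_representing_endomorphism b hgb (α x)
  choose A hA using hAex
  have habs (x : X) (i : Fin n) : |lam x i| ≤ R := (hlam x).abs_le (hb x).2 i
  have hpos (x : X) (i : Fin n) : 0 < 1 - (2 * R)⁻¹ * lam x i := by
    have h1 := (abs_le.1 (habs x i)).2
    have : (2 * R)⁻¹ * lam x i ≤ 1 / 2 := by
      rw [inv_mul_le_iff₀ (by positivity)]; linarith
    linarith
  have hvec (x : X) := (hlam x).comp_pow (hA x) (hpos x) N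
  -- Hermitian symmetry and positivity of the new form come from its orthonormal basis in `hvec`.
  refine ⟨⟨fun x => (g.form x).comp ((1 - (((2 * R)⁻¹ : ℝ) : ℂ) • A x) ^ N),
    fun x => (hvec x).conj_symm_left, fun x => (hvec x).pos_left,
    fun φ hφ i j => contDiffOn_coeff_comp_pow g hA hφ (hα φ hφ) _ N i j⟩, fun x => ?_⟩
  refine ⟨_, fun i hi => ?_, hvec x⟩
  obtain ⟨W, hWd, hW⟩ := (hb x).1
  exact hN (lam x) (habs x) i (hi.trans (hWd.trans ((hlam x).finrank_le_card hW)))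

end Manifold

end QPos

end

/-- `X` is a compact Kähler manifold of complex dimension `n` and `L` a holomorphic line bundle
on `X`. -/
theorem mainTheorem3 {n : ℕ} {X : Type*} [TopologicalSpace X] [T2Space X] [CompactSpace X]
    [ChartedSpace (QPos.Cn n) X] [IsManifold 𝓘(ℂ, QPos.Cn n) ω X]
    (hX : QPos.IsKahlerManifold n X)
    (L : X → Type*) [∀ x, AddCommGroup (L x)] [∀ x, Module ℂ (L x)]
    [∀ x, TopologicalSpace (L x)] [TopologicalSpace (TotalSpace ℂ L)] [FiberBundle ℂ L]
    [VectorBundle ℂ ℂ L] [ContMDiffVectorBundle ω ℂ L 𝓘(ℂ, QPos.Cn n)]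
    (q : ℕ) (hq : q ≤ n) (hL : QPos.IsQPositive n L q) :
    ∃ (h : QPos.HermitianMetric n L) (g : QPos.HermitianForm n X),
      QPos.IsSubharmonic h.chernCurvature g (n - q) := by
  obtain ⟨g, -⟩ := hX
  obtain ⟨h, hpos⟩ := hL
  exact ⟨h, QPos.exists_isSubharmonic g (fun φ hφ => h.contDiffOn_coeff_chernCurvature hφ) hpos⟩
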